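/- Let $\sigma,\epsilon,T>0$ and $u\in\mathbb{R}$ be constants (spatially homogeneous background), and write $\mathcal{M}=\mathcal{N}(\epsilon u,T)$ for the Maxwellian with mean $\epsilon u$ and variance $T$. For a probability measure $f$ on the phase space of pairs (position, velocity) $(x,v)\in\mathbb{R}^2$ and $\Delta t>0$, define two evolved laws. *Kinetic operator.* $\mathcal{S}_{\Delta t}(f)$ is the law at time $\Delta t$ of the Boltzmann-BGK velocity-jump process $(x(t),v(t))$ with $(x(0),v(0))\sim f$: $\mathrm{d}x/\mathrm{d}t=v/\epsilon$, the velocity is constant between collisions, the free-flight times are independent and exponentially distributed with rate $\sigma/\epsilon^2$, and at each collision the velocity is replaced by an independent sample of $\mathcal{M}$. *Kinetic-diffusion (KD) operator.* $\tilde{\mathcal{S}}_{\Delta t}(f)$ is the law after one KD step: starting from $(x,v)\sim f$, draw a free-flight time $\tau$, exponential with rate $\sigma/\epsilon^2$. If $\tau\ge\Delta t$, the result is $(x+\frac{v}{\epsilon}\Delta t,\,v)$. If $\tau<\Delta t$, put $\theta=\Delta t-\tau$, draw $\nu\sim\mathcal{M}$ and $\xi\sim\mathcal{N}(0,1)$ independently,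 and the result is $\bigl(x+\frac{v}{\epsilon}\tau+m(\theta,\nu)+\sqrt{s(\theta,\nu)}\,\xi,\ \nu\bigr)$, where $$m(\theta,\nu)=u\theta+\Bigl(\frac{\nu}{\epsilon}-u\Bigr)\frac{\epsilon^2}{\sigma}\Bigl(1-e^{-\sigma\theta/\epsilon^2}\Bigr),$$ $$s(\theta,\nu)=2T\frac{\epsilon^2}{\sigma^2}\Bigl(2e^{-\sigma\theta/\epsilon^2}+\frac{\sigma\theta}{\epsilon^2}+\frac{\sigma\theta}{\epsilon^2}e^{-\sigma\theta/\epsilon^2}-2\Bigr)+\Bigl(\frac{\nu}{\epsilon}-u\Bigr)^2\frac{\epsilon^4}{\sigma^2}\Bigl(1-\frac{2\sigma\theta}{\epsilon^2}e^{-\sigma\theta/\epsilon^2}-e^{-2\sigma\theta/\epsilon^2}\Bigr).$$ For $\kappa\ge0$ let $W_1$ be the Wasserstein-1 distance, i.e. the infimum over all joint laws with the given marginals of the mean of $|x-x'|+\kappa|v-v'|$ (for $\kappa=0$ this is the Wasserstein distance between the position marginals). Then for every fixed $\epsilon$ (and $\sigma,T,u,\kappa$), the one-step error satisfies $$W_1\bigl(\mathcal{S}_{\Delta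 t}(f),\tilde{\mathcal{S}}_{\Delta t}(f)\bigr)\le 0.24959\sqrt{\frac{T\sigma^3\Delta t^5}{\epsilon^8}}+\mathcal{O}\bigl(\sqrt{\Delta t^7}\bigr),\qquad \Delta t\to0,$$ uniformly in $f$: there are $C\in\mathbb{R}$ and $\delta>0$, depending only on $\sigma,\epsilon,T,u,\kappa$, such that for all probability measures $f$ and all $0<\Delta t\le\delta$ the left side is at most $0.24959\sqrt{T\sigma^3\Delta t^5/\epsilon^8}+C\sqrt{\Delta t^7}$. -/

import Mathlib

open MeasureTheory ProbabilityTheory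

/-! ### Wasserstein distance -/

/-- `γ` is a joint law with marginals `μ` and `ν`. -/
def IsCoupling {E : Type*} [MeasurableSpace E] (γ : Measure (E × E)) (μ ν : Measure E) : Prop :=
  γ.map Prod.fst = μ ∧ γ.map Prod.snd = ν

/-- The Wasserstein-1 distance for the ground distance `d`: the infimum over all joint laws of
the mean distance, as an element of `[0, ∞]`. -/
noncomputable def wassersteinOne {E : Type*} [MeasurableSpace E] (d : E → E → ℝ)
    (μ ν : Measure E) : ENNReal :=
  ⨅ γ : Measure (E × E), ⨅ _ : IsCoupling γ μ ν, ∫⁻ z, ENNReal.ofReal (d z.1 z.2) ∂γ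

/-- The distance `|x - x'| + κ |v - v'|` on the phase space of pairs (position, velocity). For
`κ = 0` only positions are compared. -/
def phaseDist (κ : ℝ) (p q : ℝ × ℝ) : ℝ :=
  |p.1 - q.1| + κ * |p.2 - q.2|

/-! ### The kinetic (velocity-jump) process in a homogeneous background -/

/-- The post-collisional velocity distribution: the Maxwellian with mean `ε u`, variance `T`. -/
noncomputable def maxwellian (ε u T : ℝ) : Measure ℝ :=
  gaussianReal (ε * u) T.toNNReal

/-- The time of the `k`-th collision (with time `0` for `k = 0`), given the free-flight times. -/
def collisionTime (e : ℕ → ℝ) (k : ℕ) : ℝ :=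
  ∑ i ∈ Finset.range k, e i

/-- The velocity during the `k`-th free flight: the initial velocity `v` for `k = 0`, then the
sampled post-collisional velocities. -/
def flightVelocity (v : ℝ) (w : ℕ → ℝ) : ℕ → ℝ
  | 0 => v
  | k + 1 => w k

/-- The number of collisions before time `t`: the first `k` whose next collision is not before
`t` (such a `k` exists almost surely). -/
noncomputable def collisionCount (t : ℝ) (e : ℕ → ℝ) : ℕ :=
  sInf {k : ℕ | t ≤ collisionTime e (k + 1)}

/-- The position and velocity at time `t` of the particle with initial state `ω.1`, free-flight
times `ω.2.1` and post-collisional velocities `ω.2.2`, where `dx/dt = v/ε`. -/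
noncomputable def kineticState (ε t : ℝ) (ω : (ℝ × ℝ) × (ℕ → ℝ) × (ℕ → ℝ)) : ℝ × ℝ :=
  let N := collisionCount t ω.2.1
  let V := flightVelocity ω.1.2 ω.2.2
  (ω.1.1 + ∑ k ∈ Finset.range N, V k / ε * ω.2.1 k + V N / ε * (t - collisionTime ω.2.1 N),
    V N)

/-- The kinetic evolution: the law at time `t` of the velocity-jump process started from `f`,
with independent exponential free-flight times of rate `σ / ε ^ 2` and independent Maxwellian
post-collisional velocities. -/
noncomputable def kineticOperator (σ ε u T t : ℝ) (f : Measure (ℝ × ℝ)) : Measure (ℝ × ℝ) :=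
  (f.prod ((Measure.infinitePi fun _ : ℕ => expMeasure (σ / ε ^ 2)).prod
    (Measure.infinitePi fun _ : ℕ => maxwellian ε u T))).map (kineticState ε t)

/-! ### The kinetic-diffusion scheme in a homogeneous background -/

/-- The mean of the positional increment of the kinetic process over a time `θ`, given the final
velocity `ν`. -/
noncomputable def kdMean (σ ε u θ ν : ℝ) : ℝ :=
  u * θ + (ν / ε - u) * (ε ^ 2 / σ) * (1 - Real.exp (-(σ * θ / ε ^ 2)))

/-- The variance of the positional increment of the kinetic process over a time `θ`, given the
final velocity `ν`. -/
noncomputable def kdVar (σ ε u T θ ν : ℝ) : ℝ :=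
  2 * T * (ε ^ 2 / σ ^ 2) *
      (2 * Real.exp (-(σ * θ / ε ^ 2)) + σ * θ / ε ^ 2
        + σ * θ / ε ^ 2 * Real.exp (-(σ * θ / ε ^ 2)) - 2)
    + (ν / ε - u) ^ 2 * (ε ^ 4 / σ ^ 2) *
      (1 - 2 * (σ * θ / ε ^ 2) * Real.exp (-(σ * θ / ε ^ 2)) - Real.exp (-(2 * (σ * θ / ε ^ 2))))

/-- The state after one kinetic-diffusion step of length `t`, for the initial state `ω.1`, the
free-flight time `ω.2.1`, the new velocity `ω.2.2.1` and the standard normal variable `ω.2.2.2`: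
free flight until the first collision; if it occurs before `t`, the new velocity is adopted and
the remaining time `θ = t - ω.2.1` is covered by one Gaussian step. -/
noncomputable def kdState (σ ε u T t : ℝ) (ω : (ℝ × ℝ) × ℝ × ℝ × ℝ) : ℝ × ℝ :=
  if ω.2.1 < t then
    (ω.1.1 + ω.1.2 / ε * ω.2.1 + (kdMean σ ε u (t - ω.2.1) ω.2.2.1
      + Real.sqrt (kdVar σ ε u T (t - ω.2.1) ω.2.2.1) * ω.2.2.2), ω.2.2.1)
  else (ω.1.1 + ω.1.2 / ε * t, ω.1.2)

/-- The kinetic-diffusion evolution: the law after one step of length `t` started from `f`. -/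
noncomputable def kdOperator (σ ε u T t : ℝ) (f : Measure (ℝ × ℝ)) : Measure (ℝ × ℝ) :=
  (f.prod ((expMeasure (σ / ε ^ 2)).prod
    ((maxwellian ε u T).prod (gaussianReal 0 1)))).map (kdState σ ε u T t)

/-! ### Measurability -/

theorem measurable_collisionTime (k : ℕ) : Measurable fun e : ℕ → ℝ => collisionTime e k := by
  unfold collisionTime
  fun_prop

theorem measurable_collisionCount (t : ℝ) : Measurable (collisionCount t) := by
  have hm : ∀ k, MeasurableSet {e : ℕ → ℝ | t ≤ collisionTime e (k + 1)} := fun k =>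
    measurableSet_le measurable_const (measurable_collisionTime (k + 1))
  have hle : ∀ n, MeasurableSet {e : ℕ → ℝ | n < collisionCount t e} := by
    intro n
    have : {e : ℕ → ℝ | n < collisionCount t e} =
        (⋃ k, {e : ℕ → ℝ | t ≤ collisionTime e (k + 1)}) ∩
          ⋂ k ∈ Finset.range (n + 1), {e : ℕ → ℝ | t ≤ collisionTime e (k + 1)}ᶜ := by
      ext e
      simp only [Set.mem_ofPred_eq, Set.mem_inter_iff, Set.mem_iUnion, Set.mem_iInter,
        Finset.mem_range, Set.mem_compl_iff]
      constructor
      · intro h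
        refine ⟨?_, fun k hk hmem => ?_⟩
        · exact Nat.nonempty_of_pos_sInf (lt_of_le_of_lt (Nat.zero_le n) h)
        · have : collisionCount t e ≤ k := Nat.sInf_le hmem
          omega
      · rintro ⟨hne, h⟩
        by_contra hlt
        exact h (collisionCount t e) (by omega) (Nat.sInf_mem hne)
    rw [this]
    exact (MeasurableSet.iUnion hm).inter
      (Finset.measurableSet_biInter _ fun k _ => (hm k).compl)
  exact measurable_of_Ioi hle

theorem measurable_kineticState (ε t : ℝ) : Measurable (kineticState ε t) := by
  have hV : ∀ k, Measurable fun ω : (ℝ × ℝ) × (ℕ → ℝ) × (ℕ → ℝ) =>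
      flightVelocity ω.1.2 ω.2.2 k := by
    intro k
    cases k <;> simp only [flightVelocity] <;> fun_prop
  have hN : Measurable fun ω : (ℝ × ℝ) × (ℕ → ℝ) × (ℕ → ℝ) => collisionCount t ω.2.1 :=
    (measurable_collisionCount t).comp (measurable_fst.comp measurable_snd)
  have hF : Measurable fun p : ((ℝ × ℝ) × (ℕ → ℝ) × (ℕ → ℝ)) × ℕ =>
      ((p.1.1.1 + ∑ k ∈ Finset.range p.2, flightVelocity p.1.1.2 p.1.2.2 k / ε * p.1.2.1 k
        + flightVelocity p.1.1.2 p.1.2.2 p.2 / ε * (t - collisionTime p.1.2.1 p.2),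
        flightVelocity p.1.1.2 p.1.2.2 p.2) : ℝ × ℝ) := by
    refine measurable_from_prod_countable_left fun n => ?_
    have hT : Measurable fun ω : (ℝ × ℝ) × (ℕ → ℝ) × (ℕ → ℝ) => collisionTime ω.2.1 n :=
      (measurable_collisionTime n).comp (measurable_fst.comp measurable_snd)
    have hS : Measurable fun ω : (ℝ × ℝ) × (ℕ → ℝ) × (ℕ → ℝ) =>
        ∑ k ∈ Finset.range n, flightVelocity ω.1.2 ω.2.2 k / ε * ω.2.1 k :=
      Finset.measurable_sum _ fun k _ => ((hV k).div_const ε).mul (by fun_prop)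
    exact (((measurable_fst.comp measurable_fst).add hS).add
      (((hV n).div_const ε).mul (measurable_const.sub hT))).prodMk (hV n)
  exact hF.comp (measurable_id.prodMk hN)

theorem measurable_kdState (σ ε u T t : ℝ) : Measurable (kdState σ ε u T t) := by
  unfold kdState kdMean kdVar
  refine Measurable.ite (measurableSet_lt (by fun_prop) measurable_const) ?_ ?_ <;> fun_prop

/-! Write r = σ/ε², t = Δt. The infimum over joint laws is bounded by one explicit coupling. In the
simplest one both processes share the initial state, the first flight time τ and the final velocity
ν, so that velocities agree. Two or more collisions have probability O(t²) and displace by O(t),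
costing O(t³); the mean of the Gaussian step differs from free flight by O(t²) on an event of
probability O(t). What remains is √s(θ,ν)|ξ|. Since s ≈ σθ³/(3ε⁴)·(T + (ν - εu)²), Jensen's
inequality bounds its mean to leading order by (2/5)√(2/3)√(2/π) ≈ 0.2606 times √(Tσ³t⁵/ε⁸), which
is too large.

The coupling is improved by letting the kinetic particle follow part of the noise ξ. After one
collision its position is x + vτ/ε + ν(t - τ)/ε, so lengthening τ by kξ with k = cε/(v - ν) moves it
by cξ and leaves only (s^{1/2} - c)|ξ|. The exponential law of τ must be preserved. The map (τ, ξ) ↦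
(τ + kξ - rk²/2, rk - ξ) is a volume-preserving involution that conserves rτ + ξ²/2, hence the joint
density of τ and ξ as long as flight times stay nonnegative. Moves leaving [0, t/2] are rejected,
and symmetry of the acceptance set makes the result exactly measure preserving
(`lintegral_comp_driftMove`).

The amplitude c is of order t^{3/2}, and displacement is used only for τ ≤ t/2 and |v - ν| ≥ √T/2.
Uniformly in v this has probability at least about 0.6·rt/2, so the gain has order t^{5/2}, the
leading one. The drift and the rejections cost O(t³) (`lintegral_couplingLoss_prod_le`). The leading
constant falls to 0.239 (`amplitude_sum_le`), and the strict gap to 0.24959 absorbs every O(t³) term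
for small t. -/

/-! ### A measure-preserving displacement of exponential times -/

/-- The position after time `k` of a particle of unit mass in the linear potential `r * x`, started
at position `z.1` with momentum `z.2`. -/
noncomputable def driftTarget (r k : ℝ) (z : ℝ × ℝ) : ℝ := z.1 + k * z.2 - r * k ^ 2 / 2

/-- The pairs for which both the initial position and the target lie in `[0, h]`. -/
def driftSet (r h k : ℝ) : Set (ℝ × ℝ) :=
  {z | (0 ≤ z.1 ∧ z.1 ≤ h) ∧ 0 ≤ driftTarget r k z ∧ driftTarget r k z ≤ h}

open Classical in
/-- Move to the target if this stays inside `[0, h]`, else do not move. -/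
noncomputable def driftMove (r h k : ℝ) (z : ℝ × ℝ) : ℝ :=
  if z ∈ driftSet r h k then driftTarget r k z else z.1

theorem measurable_driftTarget (r : ℝ) :
    Measurable fun q : ℝ × ℝ × ℝ => driftTarget r q.1 q.2 := by
  unfold driftTarget
  fun_prop

theorem measurableSet_driftSet (r h : ℝ) :
    MeasurableSet {q : ℝ × ℝ × ℝ | q.2 ∈ driftSet r h q.1} := by
  have h1 : Measurable fun q : ℝ × ℝ × ℝ => q.2.1 := by fun_prop
  have h2 := measurable_driftTarget r
  exact ((measurableSet_le measurable_const h1).inter (measurableSet_le h1 measurable_const)).inter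
    ((measurableSet_le measurable_const h2).inter (measurableSet_le h2 measurable_const))

theorem measurable_driftMove (r h : ℝ) :
    Measurable fun q : ℝ × ℝ × ℝ => driftMove r h q.1 q.2 := by
  unfold driftMove
  exact Measurable.ite (measurableSet_driftSet r h) (measurable_driftTarget r) (by fun_prop)

/-- The full phase-space map: move to the target and reverse the momentum. -/
noncomputable def driftFlip (r k : ℝ) (z : ℝ × ℝ) : ℝ × ℝ := (driftTarget r k z, r * k - z.2)

/-- Reversing the momentum makes the motion time-reversible. This is why acceptance is symmetric
between a point and its image. -/
theorem driftTarget_driftFlip (r k : ℝ) (z : ℝ × ℝ) :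
    driftTarget r k (driftFlip r k z) = z.1 := by
  simp only [driftFlip, driftTarget]
  ring

theorem driftFlip_mem_driftSet (r h k : ℝ) (z : ℝ × ℝ) :
    driftFlip r k z ∈ driftSet r h k ↔ z ∈ driftSet r h k := by
  simp only [driftSet, Set.mem_ofPred_eq, driftTarget_driftFlip]
  simp only [driftFlip]
  tauto

/-- For fixed momentum the position is only translated, and the momentum is reflected; both
operations preserve Lebesgue measure. -/
theorem lintegral_comp_driftFlip (r k : ℝ) {G : ℝ × ℝ → ENNReal} (hG : Measurable G) :
    ∫⁻ z, G (driftFlip r k z) = ∫⁻ z, G z := by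
  have hm : Measurable (driftFlip r k) := by
    unfold driftFlip driftTarget
    fun_prop
  rw [Measure.volume_eq_prod, lintegral_prod_symm' (fun z => G (driftFlip r k z)) (hG.comp hm),
    lintegral_prod_symm' _ hG]
  have h1 : ∀ y : ℝ, ∫⁻ x : ℝ, G (driftFlip r k (x, y)) = ∫⁻ x : ℝ, G (x, r * k - y) := by
    intro y
    simp only [driftFlip, driftTarget]
    have := lintegral_add_right_eq_self (μ := (volume : Measure ℝ))
      (fun x => G (x, r * k - y)) (k * y - r * k ^ 2 / 2)
    rw [← this]
    simp only [add_sub_assoc]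
  simp only [h1]
  exact lintegral_sub_left_eq_self (fun y : ℝ => ∫⁻ x : ℝ, G (x, y)) (r * k)

/-- The energy rx + y²/2 is conserved. Membership in `driftSet` keeps both positions nonnegative,
where the exponential density has its smooth form. -/
theorem density_driftFlip {r h k : ℝ} {z : ℝ × ℝ} (hz : z ∈ driftSet r h k) :
    exponentialPDF r (driftFlip r k z).1 * gaussianPDF 0 1 (driftFlip r k z).2 =
      exponentialPDF r z.1 * gaussianPDF 0 1 z.2 := by
  obtain ⟨⟨h0, -⟩, h1, -⟩ := hz
  have hp : ∀ x : ℝ, gaussianPDF 0 1 x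
      = ENNReal.ofReal ((Real.sqrt (2 * Real.pi))⁻¹ * Real.exp (-x ^ 2 / 2)) := by
    intro x
    simp [gaussianPDF, gaussianPDFReal]
  simp only [driftFlip]
  rw [exponentialPDF_of_nonneg h1, exponentialPDF_of_nonneg h0, hp, hp,
    ← ENNReal.ofReal_mul' (by positivity), ← ENNReal.ofReal_mul' (by positivity)]
  congr 1
  have hexp : -(r * driftTarget r k z) + -(r * k - z.2) ^ 2 / 2 = -(r * z.1) + -z.2 ^ 2 / 2 := by
    simp only [driftTarget]
    ring
  have hmul := congrArg Real.exp hexp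
  rw [Real.exp_add, Real.exp_add] at hmul
  linear_combination r * (Real.sqrt (2 * Real.pi))⁻¹ * hmul

/-- Moving an exponential time by a Gaussian displacement, with rejection outside `[0, h]`,
preserves its law. -/
theorem lintegral_comp_driftMove (r h k : ℝ) {F : ℝ → ENNReal} (hF : Measurable F)
    [IsProbabilityMeasure (expMeasure r)] :
    ∫⁻ z, F (driftMove r h k z) ∂((expMeasure r).prod (gaussianReal 0 1)) =
      ∫⁻ a, F a ∂(expMeasure r) := by
  have hA : MeasurableSet (driftSet r h k) :=
    (measurableSet_driftSet r h).preimage (measurable_prodMk_left (x := k))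
  have hmove : Measurable (driftMove r h k) :=
    (measurable_driftMove r h).comp (measurable_prodMk_left (x := k))
  have he : Measurable (exponentialPDF r) := (measurable_exponentialPDFReal r).ennreal_ofReal
  have hg : Measurable (gaussianPDF 0 1) := measurable_gaussianPDF 0 1
  set ρ : ℝ × ℝ → ENNReal := fun z => exponentialPDF r z.1 * gaussianPDF 0 1 z.2 with hρ
  have hρm : Measurable ρ := by
    rw [hρ]
    exact (he.comp measurable_fst).mul (hg.comp measurable_snd)
  have hprod : (expMeasure r).prod (gaussianReal 0 1)
      = (volume : Measure (ℝ × ℝ)).withDensity ρ := by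
    rw [gaussianReal_of_var_ne_zero 0 one_ne_zero]
    exact prod_withDensity he hg
  have hmarg : ∫⁻ a, F a ∂(expMeasure r) =
      ∫⁻ z, F z.1 ∂((expMeasure r).prod (gaussianReal 0 1)) := by
    rw [lintegral_prod (fun z : ℝ × ℝ => F z.1) (hF.comp measurable_fst).aemeasurable]
    simp
  rw [hmarg, hprod, lintegral_withDensity_eq_lintegral_mul (g := fun z => F (driftMove r h k z)) _ hρm
      (hF.comp hmove),
    lintegral_withDensity_eq_lintegral_mul (g := fun z : ℝ × ℝ => F z.1) _ hρm
      (hF.comp measurable_fst)]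
  have hsplit : ∀ H : ℝ × ℝ → ENNReal, ∫⁻ z, H z =
      (∫⁻ z, (driftSet r h k).indicator H z) + ∫⁻ z, (driftSet r h k)ᶜ.indicator H z := by
    intro H
    rw [lintegral_indicator hA, lintegral_indicator hA.compl, lintegral_add_compl _ hA]
  -- Detailed balance: on the acceptance set substitute the flip, which maps that set to itself; on
  -- the complement nothing moves.
  rw [hsplit, hsplit (fun z => (ρ * fun z : ℝ × ℝ => F z.1) z)]
  congr 1
  · refine Eq.trans (lintegral_congr fun z => ?_) (lintegral_comp_driftFlip r k
      (G := (driftSet r h k).indicator (ρ * fun z : ℝ × ℝ => F z.1))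
      ((hρm.mul (hF.comp measurable_fst)).indicator hA))
    by_cases hz : z ∈ driftSet r h k
    · rw [Set.indicator_of_mem hz, Set.indicator_of_mem ((driftFlip_mem_driftSet r h k z).2 hz)]
      simp only [Pi.mul_apply, driftMove, if_pos hz]
      rw [hρ]
      simp only
      rw [density_driftFlip hz]
      rfl
    · rw [Set.indicator_of_notMem hz,
        Set.indicator_of_notMem (mt (driftFlip_mem_driftSet r h k z).1 hz)]
  · refine lintegral_congr fun z => ?_
    by_cases hz : z ∈ (driftSet r h k)ᶜ
    · rw [Set.indicator_of_mem hz, Set.indicator_of_mem hz]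
      simp only [Pi.mul_apply, driftMove, if_neg hz]
    · rw [Set.indicator_of_notMem hz, Set.indicator_of_notMem hz]

/-! ### Resampling and permuting coordinates of an infinite product -/

section InfiniteProduct

variable {X : Type*} [MeasurableSpace X] (μ : Measure X) [IsProbabilityMeasure μ]

theorem measurable_update_prod (i : ℕ) :
    Measurable fun q : X × (ℕ → X) => Function.update q.2 i q.1 := by
  refine measurable_pi_lambda _ fun j => ?_
  by_cases hj : j = i
  · subst hj
    simpa using measurable_fst
  · simp only [Function.update_of_ne hj]
    exact (measurable_pi_apply j).comp measurable_snd

/-- Resampling one coordinate does not change the law of an i.i.d. sequence. -/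
theorem map_update_infinitePi (i : ℕ) :
    (μ.prod (Measure.infinitePi fun _ : ℕ => μ)).map
      (fun q : X × (ℕ → X) => Function.update q.2 i q.1) = Measure.infinitePi fun _ : ℕ => μ := by
  refine Measure.eq_infinitePi _ fun s t ht => ?_
  rw [Measure.map_apply (measurable_update_prod i)
    (.pi s.countable_toSet fun j _ => ht j)]
  by_cases hi : i ∈ s
  · have : (fun q : X × (ℕ → X) => Function.update q.2 i q.1) ⁻¹' (s : Set ℕ).pi t =
        t i ×ˢ ((s.erase i : Finset ℕ) : Set ℕ).pi t := by
      ext q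
      simp only [Set.mem_preimage, Set.mem_pi, Finset.mem_coe, Set.mem_prod, Finset.mem_erase]
      constructor
      · intro h
        refine ⟨by simpa using h i hi, fun j hj => ?_⟩
        simpa [Function.update_of_ne hj.1] using h j hj.2
      · rintro ⟨h1, h2⟩ j hj
        by_cases hji : j = i
        · subst hji
          simpa using h1
        · simpa [Function.update_of_ne hji] using h2 j ⟨hji, hj⟩
    rw [this, Measure.prod_prod, Measure.infinitePi_pi _ fun j _ => ht j,
      Finset.mul_prod_erase s (fun j => μ (t j)) hi]
  · have : (fun q : X × (ℕ → X) => Function.update q.2 i q.1) ⁻¹' (s : Set ℕ).pi t =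
        Set.univ ×ˢ (s : Set ℕ).pi t := by
      ext q
      simp only [Set.mem_preimage, Set.mem_pi, Finset.mem_coe, Set.mem_prod, Set.mem_univ,
        true_and]
      refine forall₂_congr fun j hj => ?_
      have : j ≠ i := fun h => hi (h ▸ hj)
      simp [Function.update_of_ne this]
    rw [this, Measure.prod_prod, Measure.infinitePi_pi _ fun j _ => ht j, measure_univ, one_mul]

/-- An i.i.d. sequence is exchangeable. -/
theorem map_comp_perm_infinitePi (p : Equiv.Perm ℕ) :
    (Measure.infinitePi fun _ : ℕ => μ).map (fun w : ℕ → X => fun j => w (p j)) =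
      Measure.infinitePi fun _ : ℕ => μ := by
  have := Measure.infinitePi_map_piCongrLeft (X := fun _ : ℕ => X) (fun _ : ℕ => μ) p.symm
  convert this using 2
  ext w j
  simp [MeasurableEquiv.piCongrLeft, Equiv.piCongrLeft_apply]

end InfiniteProduct

/-! ### The coupling -/

/-- The joint law of the initial state, the free-flight times and the post-collisional
velocities. -/
noncomputable def kineticInput (σ ε u T : ℝ) (f : Measure (ℝ × ℝ)) :
    Measure ((ℝ × ℝ) × (ℕ → ℝ) × (ℕ → ℝ)) :=
  f.prod ((Measure.infinitePi fun _ : ℕ => expMeasure (σ / ε ^ 2)).prod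
    (Measure.infinitePi fun _ : ℕ => maxwellian ε u T))

instance isProbabilityMeasure_maxwellian (ε u T : ℝ) :
    IsProbabilityMeasure (maxwellian ε u T) := by
  unfold maxwellian
  infer_instance

theorem measurable_update_driftMove (r h k : ℝ) :
    Measurable fun q : (ℕ → ℝ) × ℝ =>
      Function.update q.1 0 (driftMove r h k (q.1 0, q.2)) := by
  have h0 : Measurable fun q : (ℕ → ℝ) × ℝ => (k, q.1 0, q.2) := by fun_prop
  have h1 : Measurable fun q : (ℕ → ℝ) × ℝ => driftMove r h k (q.1 0, q.2) :=
    (measurable_driftMove r h).comp h0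
  exact (measurable_update_prod (X := ℝ) 0).comp (h1.prodMk measurable_fst)

/-- Resampling coordinate 0 on both sides isolates it from the other flight times and reduces the
claim to a single exponential variable. -/
theorem lintegral_update_driftMove (r h k : ℝ) [IsProbabilityMeasure (expMeasure r)]
    {F : (ℕ → ℝ) → ENNReal} (hF : Measurable F) :
    ∫⁻ q, F (Function.update q.1 0 (driftMove r h k (q.1 0, q.2)))
        ∂((Measure.infinitePi fun _ : ℕ => expMeasure r).prod (gaussianReal 0 1)) =
      ∫⁻ e, F e ∂(Measure.infinitePi fun _ : ℕ => expMeasure r) := by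
  set E : Measure (ℕ → ℝ) := Measure.infinitePi fun _ : ℕ => expMeasure r with hE
  have hu := measurable_update_prod (X := ℝ) 0
  have hG : Measurable fun q : (ℕ → ℝ) × ℝ =>
      F (Function.update q.1 0 (driftMove r h k (q.1 0, q.2))) :=
    hF.comp (measurable_update_driftMove r h k)
  have hmap : ∀ G : (ℕ → ℝ) → ENNReal, Measurable G →
      ∫⁻ e, G e ∂E = ∫⁻ e, ∫⁻ a, G (Function.update e 0 a) ∂(expMeasure r) ∂E := by
    intro G hGm
    conv_lhs => rw [hE, ← map_update_infinitePi (expMeasure r) 0]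
    rw [lintegral_map hGm hu]
    exact lintegral_prod_symm' (fun q : ℝ × (ℕ → ℝ) => G (Function.update q.2 0 q.1))
      (hGm.comp hu)
  rw [lintegral_prod _ hG.aemeasurable, hmap _ hG.lintegral_prod_right', hmap F hF]
  refine lintegral_congr fun e => ?_
  have hFe : Measurable fun a : ℝ => F (Function.update e 0 a) :=
    hF.comp (hu.comp (measurable_id.prodMk measurable_const))
  rw [← lintegral_comp_driftMove r h k hFe, lintegral_prod]
  · simp
  · exact (hFe.comp ((measurable_driftMove r h).comp
      (measurable_prodMk_left (x := k)))).aemeasurable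

/-- Displace the first free-flight time by a Gaussian, with an amplitude `k` depending on the
initial velocity and on the first post-collisional velocity. -/
noncomputable def displaceFlight (r h : ℝ) (k : ℝ × ℝ → ℝ)
    (ω : ((ℝ × ℝ) × (ℕ → ℝ) × (ℕ → ℝ)) × ℝ) : (ℝ × ℝ) × (ℕ → ℝ) × (ℕ → ℝ) :=
  (ω.1.1, Function.update ω.1.2.1 0
    (driftMove r h (k (ω.1.1.2, ω.1.2.2 0)) (ω.1.2.1 0, ω.2)), ω.1.2.2)

theorem measurable_displaceFlight (r h : ℝ) {k : ℝ × ℝ → ℝ} (hk : Measurable k) :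
    Measurable (displaceFlight r h k) := by
  have h0 : Measurable fun ω : ((ℝ × ℝ) × (ℕ → ℝ) × (ℕ → ℝ)) × ℝ =>
      (k (ω.1.1.2, ω.1.2.2 0), ω.1.2.1 0, ω.2) := by
    refine (hk.comp ?_).prodMk ?_ <;> fun_prop
  have h1 : Measurable fun ω : ((ℝ × ℝ) × (ℕ → ℝ) × (ℕ → ℝ)) × ℝ =>
      driftMove r h (k (ω.1.1.2, ω.1.2.2 0)) (ω.1.2.1 0, ω.2) :=
    (measurable_driftMove r h).comp h0
  have h2 : Measurable fun ω : ((ℝ × ℝ) × (ℕ → ℝ) × (ℕ → ℝ)) × ℝ =>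
      Function.update ω.1.2.1 0
        (driftMove r h (k (ω.1.1.2, ω.1.2.2 0)) (ω.1.2.1 0, ω.2)) :=
    (measurable_update_prod (X := ℝ) 0).comp (h1.prodMk (by fun_prop))
  exact (measurable_fst.comp measurable_fst).prodMk (h2.prodMk (by fun_prop))

/-- The amplitude depends only on the initial state and the sampled velocities, which are
independent of the flight times and of ξ. Conditionally on them it is a constant. -/
theorem measurePreserving_displaceFlight {σ ε : ℝ} (hr : 0 < σ / ε ^ 2) (u T h : ℝ)
    {k : ℝ × ℝ → ℝ} (hk : Measurable k) (f : Measure (ℝ × ℝ)) [IsProbabilityMeasure f] :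
    MeasurePreserving (displaceFlight (σ / ε ^ 2) h k)
      ((kineticInput σ ε u T f).prod (gaussianReal 0 1)) (kineticInput σ ε u T f) := by
  have := isProbabilityMeasure_expMeasure hr
  have hm := measurable_displaceFlight (σ / ε ^ 2) h hk
  refine ⟨hm, Measure.ext_of_lintegral _ fun F hF => ?_⟩
  set r := σ / ε ^ 2
  unfold kineticInput
  set E : Measure (ℕ → ℝ) := Measure.infinitePi fun _ : ℕ => expMeasure r
  set W : Measure (ℕ → ℝ) := Measure.infinitePi fun _ : ℕ => maxwellian ε u T
  have hFm : Measurable fun ω => F (displaceFlight r h k ω) := hF.comp hm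
  rw [lintegral_map hF hm, lintegral_prod _ hFm.aemeasurable,
    lintegral_prod _ hFm.lintegral_prod_right'.aemeasurable, lintegral_prod _ hF.aemeasurable]
  refine lintegral_congr fun p => ?_
  have hp : Measurable fun y : (ℕ → ℝ) × (ℕ → ℝ) => F (p, y) := hF.comp measurable_prodMk_left
  have hp' : Measurable fun y : (ℕ → ℝ) × (ℕ → ℝ) =>
      ∫⁻ ξ, F (displaceFlight r h k ((p, y), ξ)) ∂(gaussianReal 0 1) :=
    hFm.lintegral_prod_right'.comp (measurable_prodMk_left (x := p))
  refine Eq.trans (lintegral_prod_symm' _ hp') ?_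
  rw [lintegral_prod_symm' _ hp]
  refine lintegral_congr fun w => ?_
  have hw : Measurable fun e : ℕ → ℝ => F (p, e, w) := hp.comp measurable_prodMk_right
  rw [← lintegral_update_driftMove r h (k (p.2, w 0)) hw, lintegral_prod]
  · rfl
  · exact (hw.comp (measurable_update_driftMove r h _)).aemeasurable

/-- Exchange the first post-collisional velocity with the one that is in force at time `t`. -/
noncomputable def exchangeVelocity (t : ℝ) (ω : (ℝ × ℝ) × (ℕ → ℝ) × (ℕ → ℝ)) :
    (ℝ × ℝ) × (ℕ → ℝ) × (ℕ → ℝ) :=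
  -- The subtraction is truncated, so the transposition is trivial when there is no collision.
  (ω.1, ω.2.1, fun j => ω.2.2 (Equiv.swap 0 (collisionCount t ω.2.1 - 1) j))

theorem measurable_exchangeVelocity (t : ℝ) : Measurable (exchangeVelocity t) := by
  have hN : Measurable fun ω : (ℝ × ℝ) × (ℕ → ℝ) × (ℕ → ℝ) => collisionCount t ω.2.1 :=
    (measurable_collisionCount t).comp (measurable_fst.comp measurable_snd)
  have hF : Measurable fun q : ((ℝ × ℝ) × (ℕ → ℝ) × (ℕ → ℝ)) × ℕ =>
      fun j => q.1.2.2 (Equiv.swap 0 (q.2 - 1) j) := by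
    refine measurable_from_prod_countable_left fun n => ?_
    exact measurable_pi_lambda _ fun j =>
      (measurable_pi_apply (Equiv.swap 0 (n - 1) j)).comp (measurable_snd.comp measurable_snd)
  exact measurable_fst.prodMk ((measurable_fst.comp measurable_snd).prodMk
    (hF.comp (measurable_id.prodMk hN)))

/-- The transposition is determined by the flight times alone. Given these it is a fixed permutation
of an independent i.i.d. sequence. -/
theorem measurePreserving_exchangeVelocity {σ ε : ℝ} (hr : 0 < σ / ε ^ 2) (u T t : ℝ)
    (f : Measure (ℝ × ℝ)) [IsProbabilityMeasure f] :
    MeasurePreserving (exchangeVelocity t) (kineticInput σ ε u T f)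
      (kineticInput σ ε u T f) := by
  have := isProbabilityMeasure_expMeasure hr
  have hm := measurable_exchangeVelocity t
  refine ⟨hm, Measure.ext_of_lintegral _ fun F hF => ?_⟩
  unfold kineticInput
  have hFm := hF.comp hm
  rw [lintegral_map hF hm, lintegral_prod _ hF.aemeasurable]
  refine Eq.trans (lintegral_prod _ hFm.aemeasurable) (lintegral_congr fun p => ?_)
  have hp : Measurable fun y : (ℕ → ℝ) × (ℕ → ℝ) => F (p, y) := hF.comp measurable_prodMk_left
  have hp' : Measurable fun y : (ℕ → ℝ) × (ℕ → ℝ) => F (exchangeVelocity t (p, y)) :=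
    hFm.comp measurable_prodMk_left
  rw [lintegral_prod _ hp.aemeasurable]
  refine Eq.trans (lintegral_prod _ hp'.aemeasurable) (lintegral_congr fun e => ?_)
  have he : Measurable fun w : ℕ → ℝ => F (p, e, w) := hp.comp measurable_prodMk_left
  conv_rhs => rw [← map_comp_perm_infinitePi (maxwellian ε u T)
    (Equiv.swap 0 (collisionCount t e - 1))]
  rw [lintegral_map he (measurable_pi_lambda _ fun j => by fun_prop)]
  rfl

/-- The part of the coupling space that enters the kinetic-diffusion step. -/
def kdInput (ω : ((ℝ × ℝ) × (ℕ → ℝ) × (ℕ → ℝ)) × ℝ) : (ℝ × ℝ) × ℝ × ℝ × ℝ :=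
  (ω.1.1, ω.1.2.1 0, ω.1.2.2 0, ω.2)

theorem measurePreserving_kdInput {σ ε : ℝ} (hr : 0 < σ / ε ^ 2) (u T : ℝ)
    (f : Measure (ℝ × ℝ)) [IsProbabilityMeasure f] :
    MeasurePreserving kdInput ((kineticInput σ ε u T f).prod (gaussianReal 0 1))
      (f.prod ((expMeasure (σ / ε ^ 2)).prod
        ((maxwellian ε u T).prod (gaussianReal 0 1)))) := by
  have := isProbabilityMeasure_expMeasure hr
  have h1 := measurePreserving_eval_infinitePi (fun _ : ℕ => expMeasure (σ / ε ^ 2)) 0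
  have h2 := measurePreserving_eval_infinitePi (fun _ : ℕ => maxwellian ε u T) 0
  have h3 := ((MeasurePreserving.id f).prod (h1.prod h2)).prod
    (MeasurePreserving.id (gaussianReal 0 1))
  have h4 := measurePreserving_prodAssoc f
    ((expMeasure (σ / ε ^ 2)).prod (maxwellian ε u T)) (gaussianReal 0 1)
  have h5 := (MeasurePreserving.id f).prod (measurePreserving_prodAssoc
    (expMeasure (σ / ε ^ 2)) (maxwellian ε u T) (gaussianReal 0 1))
  exact h5.comp (h4.comp h3)

theorem measurable_phaseDist (κ : ℝ) :
    Measurable fun z : (ℝ × ℝ) × ℝ × ℝ => phaseDist κ z.1 z.2 := by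
  unfold phaseDist
  fun_prop

/-- Both processes are driven from one space: the kinetic one by the displaced and exchanged data,
the scheme by the original τ, ν and ξ. Measure preservation gives the two marginals. -/
theorem wassersteinOne_le_coupling {σ ε : ℝ} (hr : 0 < σ / ε ^ 2) (u T κ t h : ℝ)
    {k : ℝ × ℝ → ℝ} (hk : Measurable k) (f : Measure (ℝ × ℝ)) [IsProbabilityMeasure f] :
    wassersteinOne (phaseDist κ) (kineticOperator σ ε u T t f) (kdOperator σ ε u T t f) ≤
      ∫⁻ ω, ENNReal.ofReal (phaseDist κ
          (kineticState ε t (exchangeVelocity t (displaceFlight (σ / ε ^ 2) h k ω)))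
          (kdState σ ε u T t (kdInput ω)))
        ∂((kineticInput σ ε u T f).prod (gaussianReal 0 1)) := by
  have hd := measurePreserving_displaceFlight hr u T h hk f
  have hx := measurePreserving_exchangeVelocity hr u T t f
  have hi := measurePreserving_kdInput hr u T f
  have hK := (measurable_kineticState ε t).comp (hx.comp hd).measurable
  have hD := (measurable_kdState σ ε u T t).comp hi.measurable
  set P := (kineticInput σ ε u T f).prod (gaussianReal 0 1)
  have hc : IsCoupling (P.map fun ω => ((kineticState ε t ∘ exchangeVelocity t ∘
      displaceFlight (σ / ε ^ 2) h k) ω, (kdState σ ε u T t ∘ kdInput) ω))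
      (kineticOperator σ ε u T t f) (kdOperator σ ε u T t f) := by
    constructor
    · rw [Measure.map_map measurable_fst (hK.prodMk hD)]
      change P.map (kineticState ε t ∘ (exchangeVelocity t ∘ displaceFlight (σ / ε ^ 2) h k)) = _
      rw [← Measure.map_map (measurable_kineticState ε t) (hx.comp hd).measurable,
        (hx.comp hd).map_eq]
      rfl
    · rw [Measure.map_map measurable_snd (hK.prodMk hD)]
      change P.map (kdState σ ε u T t ∘ kdInput) = _
      rw [← Measure.map_map (measurable_kdState σ ε u T t) hi.measurable, hi.map_eq]
      rfl
  refine iInf₂_le_of_le _ hc (le_of_eq ?_)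
  rw [lintegral_map (measurable_phaseDist κ).ennreal_ofReal (hK.prodMk hD)]
  rfl

/-! ### Exponential times -/

theorem expMeasure_eq_withDensity (r : ℝ) :
    expMeasure r = volume.withDensity (exponentialPDF r) := rfl

theorem expMeasure_apply_le {r : ℝ} (hr : 0 ≤ r) {s : Set ℝ} (hs : MeasurableSet s) :
    expMeasure r s ≤ ENNReal.ofReal r * volume (s ∩ Set.Ici 0) := by
  rw [expMeasure_eq_withDensity, withDensity_apply _ hs,
    ← lintegral_indicator hs, ← setLIntegral_const, ← lintegral_indicator
      (hs.inter measurableSet_Ici)]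
  refine lintegral_mono fun x => ?_
  by_cases hx : x ∈ s
  · by_cases h0 : 0 ≤ x
    · rw [Set.indicator_of_mem hx, Set.indicator_of_mem (show x ∈ s ∩ Set.Ici 0 from ⟨hx, h0⟩),
        exponentialPDF_of_nonneg h0]
      refine ENNReal.ofReal_le_ofReal (mul_le_of_le_one_right hr ?_)
      rw [Real.exp_le_one_iff]
      have := mul_nonneg hr h0
      linarith
    · rw [Set.indicator_of_mem hx, exponentialPDF_of_neg (not_le.1 h0)]
      exact zero_le
  · rw [Set.indicator_of_notMem hx]
    exact zero_le

theorem expMeasure_Iio_le {r t : ℝ} (hr : 0 ≤ r) :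
    expMeasure r (Set.Iio t) ≤ ENNReal.ofReal (r * t) := by
  refine (expMeasure_apply_le hr measurableSet_Iio).trans ?_
  have : Set.Iio t ∩ Set.Ici 0 = Set.Ico 0 t := by
    ext x
    simp [and_comm]
  rw [this, Real.volume_Ico, sub_zero, ENNReal.ofReal_mul hr]

theorem ae_nonneg_expMeasure {r : ℝ} (hr : 0 ≤ r) : ∀ᵐ x ∂(expMeasure r), 0 ≤ x := by
  rw [ae_iff]
  have h : {x : ℝ | ¬ 0 ≤ x} = Set.Iio 0 := by
    ext x
    simp
  rw [h]
  simpa using expMeasure_Iio_le (t := 0) hr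

section FlightTimes

variable {r : ℝ}

theorem ae_nonneg_flightTimes (hr : 0 < r) [IsProbabilityMeasure (expMeasure r)] :
    ∀ᵐ e ∂(Measure.infinitePi fun _ : ℕ => expMeasure r), ∀ k, 0 ≤ e k := by
  rw [ae_all_iff]
  intro k
  exact (measurePreserving_eval_infinitePi (fun _ : ℕ => expMeasure r) k).quasiMeasurePreserving.ae
    (ae_nonneg_expMeasure hr.le)

theorem le_collisionTime_succ {e : ℕ → ℝ} (he : ∀ k, 0 ≤ e k) (k : ℕ) :
    e k ≤ collisionTime e (k + 1) := by
  unfold collisionTime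
  exact Finset.single_le_sum (f := e) (fun i _ => he i) (Finset.self_mem_range_succ k)

theorem collisionTime_mono {e : ℕ → ℝ} (he : ∀ k, 0 ≤ e k) {m n : ℕ} (h : m ≤ n) :
    collisionTime e m ≤ collisionTime e n :=
  Finset.sum_le_sum_of_subset_of_nonneg (Finset.range_mono h) fun i _ _ => he i

/-- Almost surely there are finitely many collisions before time `t`. -/
theorem ae_exists_le_collisionTime (hr : 0 < r) [IsProbabilityMeasure (expMeasure r)] {t : ℝ}
    (hrt : r * t < 1) :
    ∀ᵐ e ∂(Measure.infinitePi fun _ : ℕ => expMeasure r),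
      ∃ k, t ≤ collisionTime e (k + 1) := by
  -- For every n, the event that all flights are shorter than t has probability at most (rt)ⁿ.
  have hnull : (Measure.infinitePi fun _ : ℕ => expMeasure r) {e : ℕ → ℝ | ∀ k, e k < t} = 0 := by
    have hle : ∀ n : ℕ, (Measure.infinitePi fun _ : ℕ => expMeasure r)
        {e : ℕ → ℝ | ∀ k, e k < t} ≤ ENNReal.ofReal (r * t) ^ n := by
      intro n
      calc (Measure.infinitePi fun _ : ℕ => expMeasure r) {e : ℕ → ℝ | ∀ k, e k < t}
          ≤ (Measure.infinitePi fun _ : ℕ => expMeasure r)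
            ((Finset.range n : Set ℕ).pi fun _ => Set.Iio t) :=
            measure_mono fun e he k _ => he k
        _ = expMeasure r (Set.Iio t) ^ n := by
            rw [Measure.infinitePi_pi _ fun _ _ => measurableSet_Iio]
            simp
        _ ≤ ENNReal.ofReal (r * t) ^ n := by
            gcongr
            exact expMeasure_Iio_le hr.le
    have hlim := ENNReal.tendsto_pow_atTop_nhds_zero_of_lt_one
      (r := ENNReal.ofReal (r * t)) (ENNReal.ofReal_lt_one.2 hrt)
    exact le_antisymm (ge_of_tendsto' hlim hle) zero_le
  have h2 : ∀ᵐ e ∂(Measure.infinitePi fun _ : ℕ => expMeasure r), ¬ ∀ k, e k < t := by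
    rw [ae_iff]
    simpa using hnull
  filter_upwards [ae_nonneg_flightTimes hr, h2] with e he h
  push Not at h
  obtain ⟨k, hk⟩ := h
  exact ⟨k, hk.trans (le_collisionTime_succ he k)⟩

end FlightTimes

/-! ### Comparison with the process that collides at most once -/

/-- The position at time `t` if all collisions after the first are suppressed. -/
noncomputable def oneCollisionPosition (ε t : ℝ) (ω : (ℝ × ℝ) × (ℕ → ℝ) × (ℕ → ℝ)) : ℝ :=
  if ω.2.1 0 < t then ω.1.1 + ω.1.2 / ε * ω.2.1 0 + ω.2.2 0 / ε * (t - ω.2.1 0)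
  else ω.1.1 + ω.1.2 / ε * t

theorem measurable_oneCollisionPosition (ε t : ℝ) : Measurable (oneCollisionPosition ε t) := by
  unfold oneCollisionPosition
  refine Measurable.ite (measurableSet_lt (by fun_prop) measurable_const) ?_ ?_ <;> fun_prop

theorem collisionCount_eq_zero {t : ℝ} {e : ℕ → ℝ} (h : t ≤ e 0) : collisionCount t e = 0 := by
  unfold collisionCount
  rw [Nat.sInf_eq_zero]
  left
  simpa [collisionTime] using h

theorem collisionTime_lt_of_lt_collisionCount {t : ℝ} {e : ℕ → ℝ} {k : ℕ}
    (h : k < collisionCount t e) : collisionTime e (k + 1) < t :=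
  not_le.1 fun hk => Nat.notMem_of_lt_sInf h hk

theorem collisionCount_ne_zero {t : ℝ} {e : ℕ → ℝ} (h : e 0 < t)
    (hex : ∃ k, t ≤ collisionTime e (k + 1)) : collisionCount t e ≠ 0 := by
  intro h0
  have hmem := Nat.sInf_mem (s := {k : ℕ | t ≤ collisionTime e (k + 1)}) hex
  change t ≤ collisionTime e (collisionCount t e + 1) at hmem
  rw [h0] at hmem
  simp only [collisionTime, zero_add, Finset.range_one, Finset.sum_singleton] at hmem
  linarith

theorem kineticState_of_le {ε t : ℝ} {ω : (ℝ × ℝ) × (ℕ → ℝ) × (ℕ → ℝ)} (h : t ≤ ω.2.1 0) :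
    kineticState ε t ω = (ω.1.1 + ω.1.2 / ε * t, ω.1.2) := by
  simp [kineticState, collisionCount_eq_zero h, flightVelocity, collisionTime]

/-- After the exchange the velocity at time t is `w 0`, the ν of the scheme. The sum collects the
deviation from flying at `w 0` ever since the first collision; it is empty for a single collision.
-/
theorem kineticState_exchangeVelocity {ε t : ℝ} {p : ℝ × ℝ} {e w : ℕ → ℝ} {n : ℕ}
    (hn : collisionCount t e = n + 1) :
    kineticState ε t (exchangeVelocity t (p, e, w)) =
      (p.1 + p.2 / ε * e 0 + w 0 / ε * (t - e 0)
        + ∑ k ∈ Finset.range n, (w (Equiv.swap 0 n k) - w 0) / ε * e (k + 1), w 0) := by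
  simp only [kineticState, exchangeVelocity, hn, flightVelocity, Nat.add_sub_cancel,
    Equiv.swap_apply_right, Prod.mk.injEq, and_true, collisionTime]
  rw [Finset.sum_range_succ', Finset.sum_range_succ' (fun i => e i)]
  simp only [sub_div, sub_mul, Finset.sum_sub_distrib, ← Finset.mul_sum]
  ring

theorem velocity_kineticState_exchangeVelocity {ε t : ℝ} {p : ℝ × ℝ} {e w : ℕ → ℝ}
    (hex : ∃ k, t ≤ collisionTime e (k + 1)) :
    (kineticState ε t (exchangeVelocity t (p, e, w))).2 = if e 0 < t then w 0 else p.2 := by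
  split_ifs with h
  · obtain ⟨n, hn⟩ := Nat.exists_eq_succ_of_ne_zero (collisionCount_ne_zero h hex)
    rw [kineticState_exchangeVelocity hn]
  · rw [kineticState_of_le (by simpa [exchangeVelocity] using h)]
    rfl

/-- The displacement due to the second and later collisions. -/
noncomputable def laterCollisionError (ε t : ℝ) (ω : (ℝ × ℝ) × (ℕ → ℝ) × (ℕ → ℝ)) : ℝ :=
  |(kineticState ε t (exchangeVelocity t ω)).1 - oneCollisionPosition ε t ω|

theorem measurable_laterCollisionError (ε t : ℝ) : Measurable (laterCollisionError ε t) := by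
  have h1 := (measurable_kineticState ε t).comp (measurable_exchangeVelocity t)
  exact (h1.fst.sub (measurable_oneCollisionPosition ε t)).abs

theorem laterCollisionError_le {ε t : ℝ} (hε : 0 < ε) {p : ℝ × ℝ} {e w : ℕ → ℝ}
    (he : ∀ k, 0 ≤ e k) (hex : ∃ k, t ≤ collisionTime e (k + 1)) :
    laterCollisionError ε t (p, e, w) ≤ ∑ k ∈ Finset.range (collisionCount t e - 1),
      (|w (Equiv.swap 0 (collisionCount t e - 1) k)| + |w 0|) * (e (k + 1) / ε) := by
  have hsum : 0 ≤ ∑ k ∈ Finset.range (collisionCount t e - 1),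
      (|w (Equiv.swap 0 (collisionCount t e - 1) k)| + |w 0|) * (e (k + 1) / ε) :=
    Finset.sum_nonneg fun k _ => by
      have := he (k + 1)
      positivity
  by_cases h : e 0 < t
  · obtain ⟨n, hn⟩ := Nat.exists_eq_succ_of_ne_zero (collisionCount_ne_zero h hex)
    unfold laterCollisionError
    rw [kineticState_exchangeVelocity hn]
    simp only [oneCollisionPosition, if_pos h, add_sub_cancel_left]
    rw [hn, Nat.succ_sub_one]
    refine (Finset.abs_sum_le_sum_abs _ _).trans (Finset.sum_le_sum fun k _ => ?_)
    rw [abs_mul, abs_div, abs_of_pos hε, abs_of_nonneg (he _), div_mul_eq_mul_div, mul_div_assoc]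
    have h1 : 0 ≤ e (k + 1) / ε := div_nonneg (he _) hε.le
    exact mul_le_mul_of_nonneg_right (abs_sub _ _) h1
  · unfold laterCollisionError
    rw [kineticState_of_le (by simpa [exchangeVelocity] using h)]
    simpa [oneCollisionPosition, if_neg h, exchangeVelocity] using hsum

theorem sum_laterFlights_le {t : ℝ} {e : ℕ → ℝ} (he : ∀ k, 0 ≤ e k) (ht : 0 ≤ t) :
    ∑ k ∈ Finset.range (collisionCount t e - 1), e (k + 1) ≤ t := by
  rcases Nat.eq_zero_or_pos (collisionCount t e) with h | h
  · simpa [h] using ht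
  · obtain ⟨n, hn⟩ := Nat.exists_eq_succ_of_ne_zero h.ne'
    have h1 := collisionTime_lt_of_lt_collisionCount (t := t) (e := e) (k := n) (by omega)
    unfold collisionTime at h1
    rw [Finset.sum_range_succ'] at h1
    rw [hn, Nat.succ_sub_one]
    linarith [he 0]

/-- The mean displacement due to the second and later collisions is of third order. -/
theorem lintegral_laterCollisionError_le {σ ε : ℝ} (hσ : 0 < σ) (hε : 0 < ε) (u T : ℝ) {t : ℝ}
    (ht : 0 ≤ t) (hrt : σ / ε ^ 2 * t < 1) (f : Measure (ℝ × ℝ)) [IsProbabilityMeasure f] :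
    ∫⁻ ω, ENNReal.ofReal (laterCollisionError ε t ω) ∂(kineticInput σ ε u T f) ≤
      2 * (∫⁻ x, ENNReal.ofReal |x| ∂(maxwellian ε u T)) * ENNReal.ofReal (t / ε)
        * ENNReal.ofReal (σ / ε ^ 2 * t) ^ 2 := by
  have hr : 0 < σ / ε ^ 2 := by positivity
  have := isProbabilityMeasure_expMeasure hr
  set r := σ / ε ^ 2
  set m := ∫⁻ x, ENNReal.ofReal |x| ∂(maxwellian ε u T)
  unfold kineticInput
  set W : Measure (ℕ → ℝ) := Measure.infinitePi fun _ : ℕ => maxwellian ε u T with hW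
  set E : Measure (ℕ → ℝ) := Measure.infinitePi fun _ : ℕ => expMeasure r
  -- Two collisions before t force the first two flights to be shorter than t, which gives the
  -- factor (rt)².
  set A : Set (ℕ → ℝ) := (({0, 1} : Finset ℕ) : Set ℕ).pi fun _ => Set.Iio t
  have hm : ∀ i, ∫⁻ w, ENNReal.ofReal |w i| ∂W = m := fun i =>
    (measurePreserving_eval_infinitePi (fun _ : ℕ => maxwellian ε u T) i).lintegral_comp
      (f := fun x => ENNReal.ofReal |x|) (by fun_prop)
  have hA : MeasurableSet A := .pi (Finset.countable_toSet _) fun _ _ => measurableSet_Iio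
  have hEA : E A ≤ ENNReal.ofReal (r * t) ^ 2 := by
    rw [Measure.infinitePi_pi _ fun _ _ => measurableSet_Iio]
    simp only [Finset.prod_const]
    rw [Finset.card_pair zero_ne_one]
    gcongr
    exact expMeasure_Iio_le hr.le
  have hmain : ∀ p : ℝ × ℝ, ∀ᵐ e ∂E,
      ∫⁻ w, ENNReal.ofReal (laterCollisionError ε t (p, e, w)) ∂W ≤
        A.indicator (fun _ => 2 * m * ENNReal.ofReal (t / ε)) e := by
    intro p
    filter_upwards [ae_nonneg_flightTimes hr, ae_exists_le_collisionTime hr hrt] with e he hex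
    set n := collisionCount t e - 1 with hn
    have hb : ∀ w, ENNReal.ofReal (laterCollisionError ε t (p, e, w)) ≤
        ∑ k ∈ Finset.range n, (ENNReal.ofReal |w (Equiv.swap 0 n k)| + ENNReal.ofReal |w 0|)
          * ENNReal.ofReal (e (k + 1) / ε) := by
      intro w
      refine (ENNReal.ofReal_le_ofReal (laterCollisionError_le hε he hex)).trans (le_of_eq ?_)
      rw [ENNReal.ofReal_sum_of_nonneg fun k _ => by
        have := he (k + 1)
        positivity]
      refine Finset.sum_congr rfl fun k _ => ?_
      rw [ENNReal.ofReal_mul (by positivity), ENNReal.ofReal_add (abs_nonneg _) (abs_nonneg _)]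
    have hint : ∫⁻ w, ENNReal.ofReal (laterCollisionError ε t (p, e, w)) ∂W ≤
        ∑ k ∈ Finset.range n, (2 * m) * ENNReal.ofReal (e (k + 1) / ε) := by
      refine (lintegral_mono hb).trans (le_of_eq ?_)
      rw [lintegral_finsetSum _ fun k _ => by fun_prop]
      refine Finset.sum_congr rfl fun k _ => ?_
      rw [lintegral_mul_const _ (by fun_prop), lintegral_add_left (by fun_prop), hm, hm, two_mul]
    by_cases h2 : e ∈ A
    · rw [Set.indicator_of_mem h2]
      refine hint.trans ?_
      rw [← Finset.mul_sum, ← ENNReal.ofReal_sum_of_nonneg fun k _ => div_nonneg (he _) hε.le,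
        ← Finset.sum_div]
      gcongr
      exact sum_laterFlights_le he ht
    · have hn0 : n = 0 := by
        by_contra hne
        have h1 := collisionTime_lt_of_lt_collisionCount (t := t) (e := e) (k := 1) (by omega)
        refine h2 fun i hi => ?_
        have hi' : i = 0 ∨ i = 1 := by simpa using hi
        refine lt_of_le_of_lt ((le_collisionTime_succ he i).trans ?_) h1
        exact collisionTime_mono he (by omega)
      rw [hn0, Finset.sum_range_zero] at hint
      exact hint.trans zero_le
  calc _ ≤ ∫⁻ p, ∫⁻ y, ENNReal.ofReal (laterCollisionError ε t (p, y)) ∂(E.prod W) ∂f :=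
        lintegral_prod_le _
    _ ≤ ∫⁻ p, ∫⁻ e, ∫⁻ w, ENNReal.ofReal (laterCollisionError ε t (p, e, w)) ∂W ∂E ∂f :=
        lintegral_mono fun p => lintegral_prod_le _
    _ ≤ ∫⁻ _, 2 * m * ENNReal.ofReal (t / ε) * ENNReal.ofReal (r * t) ^ 2 ∂f := by
        refine lintegral_mono fun p => (lintegral_mono_ae (hmain p)).trans ?_
        rw [lintegral_indicator hA, setLIntegral_const]
        gcongr
    _ = _ := by simp

/-! ### Short-time behaviour of the mean and the variance -/

theorem abs_exp_neg_sub_cubic_le {a : ℝ} (h0 : 0 ≤ a) (h1 : a ≤ 1) :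
    |Real.exp (-a) - (1 - a + a ^ 2 / 2 - a ^ 3 / 6)| ≤ a ^ 4 * (5 / 96) := by
  have h := Real.exp_bound (x := -a) (by rw [abs_neg, abs_of_nonneg h0]; exact h1)
    (n := 4) (by norm_num)
  rw [abs_neg, abs_of_nonneg h0] at h
  simp only [Finset.sum_range_succ, Finset.sum_range_zero, Nat.factorial] at h
  convert h using 2 <;> norm_num
  ring

/-- The Taylor terms below order three cancel and leave a³/6. The upper bound must be nearly sharp
since it enters the leading constant; the lower one only fixes the amplitude c and may lose a factor
4. -/
theorem diffusive_variance_bounds {a : ℝ} (h0 : 0 ≤ a) (h1 : a ≤ 1 / 1000) :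
    a ^ 3 / 24 ≤ 2 * Real.exp (-a) + a + a * Real.exp (-a) - 2 ∧
      2 * Real.exp (-a) + a + a * Real.exp (-a) - 2 ≤ 1.01 * (a ^ 3 / 6) := by
  obtain ⟨hl, hu⟩ := abs_le.1 (abs_exp_neg_sub_cubic_le h0 (by linarith))
  have h3 : 0 ≤ a ^ 3 := by positivity
  have h4 : a ^ 4 ≤ a ^ 3 * (1 / 1000) := by
    rw [pow_succ]
    exact mul_le_mul_of_nonneg_left h1 h3
  have h5 : 0 ≤ a ^ 4 := by positivity
  have hl' := mul_le_mul_of_nonneg_left hl (by linarith : 0 ≤ 2 + a)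
  have hu' := mul_le_mul_of_nonneg_left hu (by linarith : 0 ≤ 2 + a)
  have h6 : a * a ^ 4 ≤ a ^ 4 := mul_le_of_le_one_left h5 (by linarith)
  constructor <;> nlinarith

/-- The first nonvanishing Taylor term is a³/3. Of the lower bound only the sign matters. -/
theorem ballistic_variance_bounds {a : ℝ} (h0 : 0 ≤ a) (h1 : a ≤ 1 / 1000) :
    0 ≤ 1 - 2 * a * Real.exp (-a) - Real.exp (-(2 * a)) ∧
      1 - 2 * a * Real.exp (-a) - Real.exp (-(2 * a)) ≤ 1.01 * (a ^ 3 / 3) := by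
  obtain ⟨hl, hu⟩ := abs_le.1 (abs_exp_neg_sub_cubic_le h0 (by linarith))
  obtain ⟨hl2, hu2⟩ := abs_le.1
    (abs_exp_neg_sub_cubic_le (a := 2 * a) (by linarith) (by linarith))
  have h3 : 0 ≤ a ^ 3 := by positivity
  have h4 : a ^ 4 ≤ a ^ 3 * (1 / 1000) := by
    rw [pow_succ]
    exact mul_le_mul_of_nonneg_left h1 h3
  have h5 : 0 ≤ a ^ 4 := by positivity
  have hl' := mul_le_mul_of_nonneg_left hl (by linarith : 0 ≤ 2 * a)
  have hu' := mul_le_mul_of_nonneg_left hu (by linarith : 0 ≤ 2 * a)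
  have h6 : a * a ^ 4 ≤ a ^ 4 := mul_le_of_le_one_left h5 (by linarith)
  constructor <;> nlinarith

section Bounds

variable {σ ε u T θ ν : ℝ}

theorem kdVar_le (hσ : 0 < σ) (hε : 0 < ε) (hT : 0 < T) (hθ : 0 ≤ θ)
    (hs : σ / ε ^ 2 * θ ≤ 1 / 1000) :
    kdVar σ ε u T θ ν ≤ 1.01 * σ / (3 * ε ^ 4) * (T + (ν - ε * u) ^ 2) * θ ^ 3 := by
  have ha : σ * θ / ε ^ 2 = σ / ε ^ 2 * θ := by ring
  have h0 : 0 ≤ σ / ε ^ 2 * θ := by positivity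
  have h1 := (diffusive_variance_bounds h0 hs).2
  have h2 := (ballistic_variance_bounds h0 hs).2
  unfold kdVar
  rw [ha]
  have h3 := mul_le_mul_of_nonneg_left h1 (by positivity : 0 ≤ 2 * T * (ε ^ 2 / σ ^ 2))
  have h4 := mul_le_mul_of_nonneg_left h2
    (by positivity : 0 ≤ (ν / ε - u) ^ 2 * (ε ^ 4 / σ ^ 2))
  refine (add_le_add h3 h4).trans (le_of_eq ?_)
  field_simp
  ring

theorem le_kdVar (hσ : 0 < σ) (hε : 0 < ε) (hT : 0 < T) (hθ : 0 ≤ θ)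
    (hs : σ / ε ^ 2 * θ ≤ 1 / 1000) :
    T * σ / (12 * ε ^ 4) * θ ^ 3 ≤ kdVar σ ε u T θ ν := by
  have ha : σ * θ / ε ^ 2 = σ / ε ^ 2 * θ := by ring
  have h0 : 0 ≤ σ / ε ^ 2 * θ := by positivity
  have h1 := (diffusive_variance_bounds h0 hs).1
  have h2 := (ballistic_variance_bounds h0 hs).1
  unfold kdVar
  rw [ha]
  have h3 := mul_le_mul_of_nonneg_left h1 (by positivity : 0 ≤ 2 * T * (ε ^ 2 / σ ^ 2))
  have h4 := mul_nonneg (by positivity : 0 ≤ (ν / ε - u) ^ 2 * (ε ^ 4 / σ ^ 2)) h2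
  refine le_trans (le_of_eq ?_) (h3.trans (le_add_of_nonneg_right h4))
  field_simp
  ring

theorem sqrt_kdVar_le (hσ : 0 < σ) (hε : 0 < ε) (hT : 0 < T) (hθ : 0 ≤ θ)
    (hs : σ / ε ^ 2 * θ ≤ 1 / 1000) :
    Real.sqrt (kdVar σ ε u T θ ν) ≤ Real.sqrt (1.01 * σ / (3 * ε ^ 4)) *
      (Real.sqrt (θ ^ 3) * Real.sqrt (T + (ν - ε * u) ^ 2)) := by
  rw [← Real.sqrt_mul (by positivity), ← Real.sqrt_mul (by positivity)]
  refine Real.sqrt_le_sqrt ((kdVar_le hσ hε hT hθ hs).trans (le_of_eq ?_))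
  ring

/-- With a = σθ/ε² the difference is (ν/ε - u)(ε²/σ)(e^{-a} - 1 + a), and the last factor is at most
a². -/
theorem abs_kdMean_sub_le (hσ : 0 < σ) (hε : 0 < ε) (hθ : 0 ≤ θ)
    (hs : σ / ε ^ 2 * θ ≤ 1 / 1000) :
    |ν / ε * θ - kdMean σ ε u θ ν| ≤ |ν / ε - u| * (σ / ε ^ 2 * θ ^ 2) := by
  have h0 : 0 ≤ σ / ε ^ 2 * θ := by positivity
  have ha : σ * θ / ε ^ 2 = σ / ε ^ 2 * θ := by ring
  have h := Real.abs_exp_sub_one_sub_id_le (x := -(σ / ε ^ 2 * θ))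
    (by rw [abs_neg, abs_of_nonneg h0]; linarith)
  have key : ν / ε * θ - kdMean σ ε u θ ν = (ν / ε - u) * (ε ^ 2 / σ *
      (Real.exp (-(σ / ε ^ 2 * θ)) - 1 - -(σ / ε ^ 2 * θ))) := by
    unfold kdMean
    rw [ha]
    field_simp
    ring
  rw [key, abs_mul, abs_mul, abs_of_pos (by positivity : 0 < ε ^ 2 / σ)]
  refine mul_le_mul_of_nonneg_left ?_ (abs_nonneg _)
  refine (mul_le_mul_of_nonneg_left h (by positivity)).trans (le_of_eq ?_)
  field_simp

end Bounds

/-! ### Pointwise error of the coupling -/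

/-- The displacement amplitude in time that produces the amplitude `c` in position. It vanishes
if the two velocities are closer than `η`. -/
noncomputable def flightAmplitude (ε c η : ℝ) (q : ℝ × ℝ) : ℝ :=
  if η ≤ |q.1 - q.2| then c * ε / (q.1 - q.2) else 0

theorem measurable_flightAmplitude (ε c η : ℝ) : Measurable (flightAmplitude ε c η) := by
  unfold flightAmplitude
  refine Measurable.ite (measurableSet_le measurable_const (by fun_prop)) ?_ measurable_const
  fun_prop

theorem abs_flightAmplitude_le {ε c η : ℝ} (hε : 0 < ε) (hc : 0 ≤ c) (hη : 0 < η) (q : ℝ × ℝ) :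
    |flightAmplitude ε c η q| ≤ c * ε / η := by
  unfold flightAmplitude
  split_ifs with h
  · rw [abs_div, abs_of_nonneg (by positivity : 0 ≤ c * ε)]
    gcongr
  · rw [abs_zero]
    positivity

/-- The gain of the displaced coupling over the one without displacement. -/
noncomputable def couplingGain (c η h v τ ν : ℝ) : ℝ :=
  if η ≤ |v - ν| ∧ τ ≤ h then c else 0

open Classical in
/-- The loss of the displaced coupling due to rejected displacements. -/
noncomputable def couplingLoss (r c η h ε v τ ν ξ : ℝ) : ℝ :=
  if (η ≤ |v - ν| ∧ τ ≤ h) ∧ (τ, ξ) ∉ driftSet r h (flightAmplitude ε c η (v, ν)) then c * |ξ|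
  else 0

/-- An accepted displacement cancels cξ out of sξ, up to the drift rk²/2 converted into position. If
the velocities are close then k = 0 and nothing is gained; after a rejection the gain subtracted in
the bound is returned by `couplingLoss`. -/
theorem abs_displaced_error_le {r c η h ε v τ ν ξ s D θ : ℝ} (hε : 0 < ε)
    (hη : 0 < η) (hr : 0 < r) (hs : τ ≤ h → c ≤ s) (hs0 : 0 ≤ s) :
    |v / ε * driftMove r h (flightAmplitude ε c η (v, ν)) (τ, ξ)
        + ν / ε * (τ + θ - driftMove r h (flightAmplitude ε c η (v, ν)) (τ, ξ))
        - (v / ε * τ + (D + s * ξ))| ≤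
      |ν / ε * θ - D| + r * c ^ 2 * ε / (2 * η) + (s - couplingGain c η h v τ ν) * |ξ|
        + couplingLoss r c η h ε v τ ν ξ := by
  have hpos : 0 ≤ r * c ^ 2 * ε / (2 * η) := by positivity
  by_cases hd : (τ, ξ) ∈ driftSet r h (flightAmplitude ε c η (v, ν))
  · have hτ : τ ≤ h := hd.1.2
    have hmove : driftMove r h (flightAmplitude ε c η (v, ν)) (τ, ξ) =
        τ + flightAmplitude ε c η (v, ν) * ξ - r * flightAmplitude ε c η (v, ν) ^ 2 / 2 :=
      if_pos hd
    have hloss : couplingLoss r c η h ε v τ ν ξ = 0 := if_neg fun h => h.2 hd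
    by_cases hg : η ≤ |v - ν|
    · have hne : v - ν ≠ 0 := by
        intro h0
        rw [h0, abs_zero] at hg
        linarith
      have hk : flightAmplitude ε c η (v, ν) = c * ε / (v - ν) := if_pos hg
      have hgain : couplingGain c η h v τ ν = c := if_pos ⟨hg, hτ⟩
      rw [hmove, hk, hgain, hloss]
      have key : v / ε * (τ + c * ε / (v - ν) * ξ - r * (c * ε / (v - ν)) ^ 2 / 2)
          + ν / ε * (τ + θ - (τ + c * ε / (v - ν) * ξ - r * (c * ε / (v - ν)) ^ 2 / 2))
          - (v / ε * τ + (D + s * ξ)) =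
          (ν / ε * θ - D) + -(r * c ^ 2 * ε / (2 * (v - ν))) + -((s - c) * ξ) := by
        field_simp
        ring
      rw [key, add_zero]
      refine (abs_add_three _ _ _).trans ?_
      rw [abs_neg, abs_neg, abs_mul (s - c), abs_of_nonneg (sub_nonneg.2 (hs hτ)), abs_div,
        abs_mul 2, abs_of_nonneg (by positivity : 0 ≤ r * c ^ 2 * ε), abs_two]
      gcongr
    · have hk : flightAmplitude ε c η (v, ν) = 0 := if_neg hg
      have hgain : couplingGain c η h v τ ν = 0 := if_neg fun h => hg h.1
      rw [hmove, hk, hgain, hloss]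
      have key : v / ε * (τ + 0 * ξ - r * 0 ^ 2 / 2) + ν / ε * (τ + θ - (τ + 0 * ξ - r * 0 ^ 2 / 2))
          - (v / ε * τ + (D + s * ξ)) = (ν / ε * θ - D) + -(s * ξ) := by ring
      rw [key]
      refine (abs_add_le _ _).trans ?_
      rw [abs_neg, abs_mul, abs_of_nonneg hs0]
      linarith
  · simp only [driftMove, if_neg hd]
    have key : v / ε * τ + ν / ε * (τ + θ - τ) - (v / ε * τ + (D + s * ξ)) =
        (ν / ε * θ - D) + -(s * ξ) := by ring
    rw [key]
    refine (abs_add_le _ _).trans ?_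
    rw [abs_neg, abs_mul, abs_of_nonneg hs0]
    by_cases hg : η ≤ |v - ν| ∧ τ ≤ h
    · simp only [couplingGain, couplingLoss, hg, hd, not_false_eq_true, and_self, if_true]
      linarith
    · simp only [couplingGain, couplingLoss, hg, false_and, if_false]
      linarith

/-! ### Moments -/

theorem integrable_abs_gaussianReal (m : ℝ) (v : NNReal) :
    Integrable (fun x : ℝ => |x|) (gaussianReal m v) := by
  have := (memLp_id_gaussianReal (μ := m) (v := v) 1).integrable (by simp)
  exact this.abs

theorem integrable_sub_sq_gaussianReal (m a : ℝ) (v : NNReal) :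
    Integrable (fun x : ℝ => (x - a) ^ 2) (gaussianReal m v) := by
  have h := (memLp_id_gaussianReal (μ := m) (v := v) 2)
  exact (h.sub (memLp_const a)).integrable_sq

theorem integral_sub_mean_sq_gaussianReal (m : ℝ) (v : NNReal) :
    ∫ x, (x - m) ^ 2 ∂(gaussianReal m v) = v := by
  rw [← variance_fun_id_gaussianReal (μ := m) (v := v), variance_eq_integral (by fun_prop)]
  simp only [integral_id_gaussianReal]

theorem integral_abs_gaussianReal : ∫ x, |x| ∂(gaussianReal 0 1) = Real.sqrt (2 / Real.pi) := by
  rw [integral_gaussianReal_eq_integral_smul one_ne_zero]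
  have h1 : ∀ x : ℝ, gaussianPDFReal 0 1 x • |x| =
      (fun y : ℝ => (Real.sqrt (2 * Real.pi))⁻¹ *
        (y ^ (1 : ℝ) * Real.exp (-(1 / 2) * y ^ (2 : ℝ)))) |x| := by
    intro x
    simp only [gaussianPDFReal, NNReal.coe_one, mul_one, sub_zero, smul_eq_mul, Real.rpow_one,
      Real.rpow_two, sq_abs]
    rw [mul_assoc, mul_comm (Real.exp _)]
    congr 4
    ring
  rw [integral_congr_ae (ae_of_all _ h1), integral_comp_abs (f := fun y : ℝ =>
    (Real.sqrt (2 * Real.pi))⁻¹ * (y ^ (1 : ℝ) * Real.exp (-(1 / 2) * y ^ (2 : ℝ)))),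
    integral_const_mul,
    integral_rpow_mul_exp_neg_mul_rpow (by norm_num) (by norm_num) (by norm_num)]
  have h2 : ((1 : ℝ) + 1) / 2 = 1 := by norm_num
  have h3 : (-(1 + 1) / 2 : ℝ) = -1 := by norm_num
  rw [h2, h3, Real.Gamma_one, Real.rpow_neg_one, Real.sqrt_div' _ Real.pi_pos.le,
    Real.sqrt_mul zero_le_two]
  have h4 : Real.sqrt 2 ≠ 0 := by positivity
  have h5 : Real.sqrt Real.pi ≠ 0 := by positivity
  field_simp
  rw [Real.sq_sqrt zero_le_two]

/-! ### Averages over the Maxwellian velocity. -/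

section Maxwellian

variable {ε u T : ℝ}

theorem integrable_sqrt_maxwellian (hT : 0 < T) :
    Integrable (fun ν => Real.sqrt (T + (ν - ε * u) ^ 2)) (maxwellian ε u T) := by
  have h1 : Integrable (fun ν => T + (ν - ε * u) ^ 2) (maxwellian ε u T) :=
    (integrable_const T).add (integrable_sub_sq_gaussianReal _ _ _)
  refine ((integrable_const 1).add h1).mono' (by fun_prop) (ae_of_all _ fun ν => ?_)
  rw [Real.norm_of_nonneg (Real.sqrt_nonneg _)]
  have h0 : 0 ≤ T + (ν - ε * u) ^ 2 := by positivity
  have := Real.sq_sqrt h0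
  simp only [Pi.add_apply]
  nlinarith [sq_nonneg (Real.sqrt (T + (ν - ε * u) ^ 2) - 1)]

/-- Jensen's inequality in explicit form: the square root lies below its tangent at 2T, the mean of
T + (ν - εu)². -/
theorem integral_sqrt_maxwellian_le (hT : 0 < T) :
    ∫ ν, Real.sqrt (T + (ν - ε * u) ^ 2) ∂(maxwellian ε u T) ≤ Real.sqrt (2 * T) := by
  have h1 : Integrable (fun ν => (ν - ε * u) ^ 2) (maxwellian ε u T) :=
    integrable_sub_sq_gaussianReal _ _ _
  have hs : 0 < Real.sqrt (2 * T) := by positivity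
  have hsq := Real.sq_sqrt (by positivity : 0 ≤ 2 * T)
  calc ∫ ν, Real.sqrt (T + (ν - ε * u) ^ 2) ∂(maxwellian ε u T)
      ≤ ∫ ν, (2 * Real.sqrt (2 * T))⁻¹ * (3 * T + (ν - ε * u) ^ 2) ∂(maxwellian ε u T) := by
        refine integral_mono (integrable_sqrt_maxwellian hT)
          (((integrable_const _).add h1).const_mul _) fun ν => ?_
        have h0 : 0 ≤ T + (ν - ε * u) ^ 2 := by positivity
        have := Real.sq_sqrt h0
        simp only
        rw [inv_mul_eq_div, le_div_iff₀ (by positivity)]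
        nlinarith [sq_nonneg (Real.sqrt (T + (ν - ε * u) ^ 2) - Real.sqrt (2 * T))]
    _ = Real.sqrt (2 * T) := by
        rw [integral_const_mul, integral_add (integrable_const _) h1, integral_const]
        unfold maxwellian
        rw [integral_sub_mean_sq_gaussianReal, Real.coe_toNNReal _ hT.le]
        simp only [probReal_univ, smul_eq_mul, one_mul]
        field_simp
        rw [hsq]
        ring

/-- A Maxwellian velocity differs from a given one by half a standard deviation with probability
at least `0.6`. -/
theorem le_maxwellian_real_far (hT : 0 < T) (v : ℝ) :
    0.6 ≤ (maxwellian ε u T).real {ν | Real.sqrt T / 2 ≤ |v - ν|} := by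
  have hT' : T.toNNReal ≠ 0 := by simpa using hT
  have hms : MeasurableSet {ν : ℝ | Real.sqrt T / 2 ≤ |v - ν|} :=
    measurableSet_le measurable_const (by fun_prop)
  have hc : {ν : ℝ | Real.sqrt T / 2 ≤ |v - ν|}ᶜ ⊆
      Set.Ioo (v - Real.sqrt T / 2) (v + Real.sqrt T / 2) := by
    intro ν hν
    simp only [Set.mem_compl_iff, Set.mem_ofPred_eq, not_le, abs_lt] at hν
    constructor <;> linarith
  have hsT : 0 < Real.sqrt T := Real.sqrt_pos.2 hT
  -- An interval of length √T has Maxwellian mass at most 1/√(2π), by the maximum of the density;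
  -- and 2.5² = 6.25 < 2π.
  have hpi : 0.4⁻¹ ≤ Real.sqrt (2 * Real.pi) := by
    refine Real.le_sqrt_of_sq_le ?_
    have := Real.pi_gt_d4
    norm_num at this ⊢
    linarith
  have hle : maxwellian ε u T (Set.Ioo (v - Real.sqrt T / 2) (v + Real.sqrt T / 2)) ≤
      ENNReal.ofReal 0.4 := by
    unfold maxwellian
    rw [gaussianReal_apply _ hT']
    calc ∫⁻ x in Set.Ioo (v - Real.sqrt T / 2) (v + Real.sqrt T / 2),
          gaussianPDF (ε * u) T.toNNReal x
        ≤ ∫⁻ _ in Set.Ioo (v - Real.sqrt T / 2) (v + Real.sqrt T / 2),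
          ENNReal.ofReal (Real.sqrt (2 * Real.pi * T))⁻¹ := by
          refine lintegral_mono fun x => ENNReal.ofReal_le_ofReal ?_
          rw [gaussianPDFReal, Real.coe_toNNReal _ hT.le]
          refine mul_le_of_le_one_right (by positivity) (Real.exp_le_one_iff.2 ?_)
          rw [neg_div]
          have : 0 ≤ (x - ε * u) ^ 2 / (2 * T) := by positivity
          linarith
      _ = ENNReal.ofReal (Real.sqrt (2 * Real.pi))⁻¹ := by
          rw [setLIntegral_const, Real.volume_Ioo, ← ENNReal.ofReal_mul (by positivity),
            Real.sqrt_mul (by positivity)]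
          congr 1
          field_simp
          ring
      _ ≤ ENNReal.ofReal 0.4 := by
          refine ENNReal.ofReal_le_ofReal ?_
          exact inv_le_of_inv_le₀ (by norm_num) hpi
  have h1 : (maxwellian ε u T).real {ν | Real.sqrt T / 2 ≤ |v - ν|}ᶜ ≤ 0.4 :=
    ENNReal.toReal_le_of_le_ofReal (by norm_num) ((measure_mono hc).trans hle)
  have h2 := probReal_compl_eq_one_sub (μ := maxwellian ε u T) hms
  rw [h2] at h1
  norm_num at h1 ⊢
  linarith

end Maxwellian

/-! ### Averages over the exponential flight time. -/

section Exponential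

variable {r : ℝ}

theorem expMeasure_le_smul (hr : 0 ≤ r) :
    expMeasure r ≤ ENNReal.ofReal r • (volume : Measure ℝ).restrict (Set.Ici 0) := by
  refine Measure.le_iff.2 fun s hs => ?_
  rw [Measure.smul_apply, Measure.restrict_apply hs, smul_eq_mul]
  exact expMeasure_apply_le hr hs

theorem le_expMeasure_real_Iic (hr : 0 < r) [IsProbabilityMeasure (expMeasure r)] {h : ℝ}
    (h0 : 0 ≤ h) (hs : r * h ≤ 1 / 100) : 0.99 * (r * h) ≤ (expMeasure r).real (Set.Iic h) := by
  rw [← cdf_eq_real, cdf_expMeasure_eq hr, if_pos h0]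
  have h1 : 0 ≤ r * h := by positivity
  have h2 := Real.abs_exp_sub_one_sub_id_le (x := -(r * h))
    (by rw [abs_neg, abs_of_nonneg h1]; linarith)
  have h3 := (abs_le.1 h2).2
  nlinarith

/-- The scaled standard deviation of the Gaussian step, as a function of the first flight time. -/
noncomputable def stepScale (t τ : ℝ) : ℝ :=
  (Set.Iio t).indicator (fun τ => Real.sqrt ((t - τ) ^ 3)) τ

theorem measurable_stepScale (t : ℝ) : Measurable (stepScale t) := by
  unfold stepScale
  exact Measurable.indicator (by fun_prop) measurableSet_Iio

theorem stepScale_nonneg (t τ : ℝ) : 0 ≤ stepScale t τ :=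
  Set.indicator_nonneg (fun _ _ => Real.sqrt_nonneg _) τ

theorem integral_sqrt_cube {t : ℝ} (ht : 0 ≤ t) :
    ∫ τ in (0 : ℝ)..t, Real.sqrt ((t - τ) ^ 3) = 2 / 5 * Real.sqrt (t ^ 5) := by
  rw [intervalIntegral.integral_comp_sub_left (fun x => Real.sqrt (x ^ 3)) t, sub_self, sub_zero]
  have h1 : ∀ x ∈ Set.uIcc 0 t, Real.sqrt (x ^ 3) = x ^ (3 / 2 : ℝ) := by
    intro x hx
    rw [Set.uIcc_of_le ht] at hx
    rw [Real.sqrt_eq_rpow, ← Real.rpow_natCast_mul hx.1]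
    norm_num
  rw [intervalIntegral.integral_congr h1, integral_rpow (by left; norm_num),
    Real.sqrt_eq_rpow, ← Real.rpow_natCast_mul ht, Real.zero_rpow (by norm_num)]
  norm_num
  ring

theorem integrableOn_stepScale (t : ℝ) :
    Integrable (stepScale t) ((volume : Measure ℝ).restrict (Set.Ici 0)) := by
  have hc : Continuous fun τ : ℝ => Real.sqrt ((t - τ) ^ 3) := by fun_prop
  have h1 : IntegrableOn (fun τ : ℝ => Real.sqrt ((t - τ) ^ 3)) (Set.Ici 0 ∩ Set.Iio t) := by
    refine (hc.integrableOn_Icc (a := 0) (b := t)).mono_set fun x hx => ⟨hx.1, hx.2.le⟩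
  have h2 : (stepScale t) = (Set.Iio t).indicator fun τ => Real.sqrt ((t - τ) ^ 3) := rfl
  rw [h2, integrable_indicator_iff measurableSet_Iio, IntegrableOn,
    Measure.restrict_restrict measurableSet_Iio, Set.inter_comm]
  exact h1

theorem integrable_stepScale (hr : 0 ≤ r) (t : ℝ) : Integrable (stepScale t) (expMeasure r) :=
  ((integrableOn_stepScale t).smul_measure ENNReal.ofReal_ne_top).mono_measure
    (expMeasure_le_smul hr)

theorem integral_stepScale_le (hr : 0 ≤ r) {t : ℝ} (ht : 0 ≤ t) :
    ∫ τ, stepScale t τ ∂(expMeasure r) ≤ r * (2 / 5 * Real.sqrt (t ^ 5)) := by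
  refine (integral_mono_measure (expMeasure_le_smul hr) (ae_of_all _ (stepScale_nonneg t))
    ((integrableOn_stepScale t).smul_measure ENNReal.ofReal_ne_top)).trans (le_of_eq ?_)
  rw [integral_smul_measure, ENNReal.toReal_ofReal hr, smul_eq_mul]
  congr 1
  have h2 : (stepScale t) = (Set.Iio t).indicator fun τ => Real.sqrt ((t - τ) ^ 3) := rfl
  rw [h2, integral_indicator measurableSet_Iio, Measure.restrict_restrict measurableSet_Iio,
    ← integral_sqrt_cube ht, intervalIntegral.integral_of_le ht, integral_Ioc_eq_integral_Ioo,
    ← integral_Ico_eq_integral_Ioo]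
  congr 2
  ext x
  simp [and_comm]

/-- The mean loss due to rejected displacements. -/
theorem lintegral_couplingLoss_le (hr : 0 < r) {c η h ε v ν ξ : ℝ} (hc : 0 ≤ c) :
    ∫⁻ τ, ENNReal.ofReal (couplingLoss r c η h ε v τ ν ξ) ∂(expMeasure r) ≤
      ENNReal.ofReal (c * |ξ| * (r * |flightAmplitude ε c η (v, ν) * ξ
        - r * flightAmplitude ε c η (v, ν) ^ 2 / 2|)) := by
  set k := flightAmplitude ε c η (v, ν) with hk
  set d := k * ξ - r * k ^ 2 / 2 with hd
  -- For a flight time in [0, h], rejection of a shift by d means leaving through 0 or through h. By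
  -- the sign of d only one of the two intervals is nonempty, and its length is |d|.
  set A : Set ℝ := Set.Ico 0 (-d) ∪ Set.Ioc (h - d) h with hA
  have hAm : MeasurableSet A := measurableSet_Ico.union measurableSet_Ioc
  have hle : ∀ᵐ τ ∂(expMeasure r), ENNReal.ofReal (couplingLoss r c η h ε v τ ν ξ) ≤
      A.indicator (fun _ => ENNReal.ofReal (c * |ξ|)) τ := by
    filter_upwards [ae_nonneg_expMeasure hr.le] with τ hτ
    unfold couplingLoss
    split_ifs with hcond
    · have hmem : τ ∈ A := by
        obtain ⟨⟨-, hτh⟩, hnot⟩ := hcond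
        by_contra hcon
        refine hnot ⟨⟨hτ, hτh⟩, ?_⟩
        simp only [hA, Set.mem_union, Set.mem_Ico, Set.mem_Ioc, not_or, not_and, not_lt,
          not_le] at hcon
        have h1 := hcon.1 hτ
        have h2 : τ ≤ h - d := by
          by_contra h3
          exact absurd (hcon.2 (not_le.1 h3)) (not_lt.2 hτh)
        simp only [driftTarget, ← hk]
        constructor <;> linarith
      rw [Set.indicator_of_mem hmem]
    · simp
  refine (lintegral_mono_ae hle).trans ?_
  rw [lintegral_indicator hAm, setLIntegral_const, ENNReal.ofReal_mul (p := c * |ξ|) (by positivity),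
    ENNReal.ofReal_mul hr.le]
  gcongr
  refine (expMeasure_apply_le hr.le hAm).trans ?_
  gcongr
  refine (measure_mono Set.inter_subset_left).trans ((measure_union_le _ _).trans ?_)
  rw [Real.volume_Ico, Real.volume_Ioc]
  rcases le_total 0 d with h0 | h0
  · rw [ENNReal.ofReal_of_nonpos (by linarith : -d - 0 ≤ 0), zero_add, abs_of_nonneg h0]
    exact ENNReal.ofReal_le_ofReal (by linarith)
  · rw [ENNReal.ofReal_of_nonpos (by linarith : h - (h - d) ≤ 0), add_zero, abs_of_nonpos h0]
    exact ENNReal.ofReal_le_ofReal (by linarith)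

end Exponential

/-! ### The one-step error -/

/-- The amplitude of the displacement used for a step of length `t`. -/
noncomputable def stepAmplitude (σ ε T t : ℝ) : ℝ :=
  -- The bound of `le_kdVar` at θ = t/2, hence at most √s for every τ ≤ t/2, whatever ν is.
  Real.sqrt (T * σ / (12 * ε ^ 4) * (t / 2) ^ 3)

theorem stepAmplitude_sq {σ ε T t : ℝ} (hσ : 0 < σ) (hε : 0 < ε) (hT : 0 < T) (ht : 0 ≤ t) :
    stepAmplitude σ ε T t ^ 2 = T * σ / (12 * ε ^ 4) * (t / 2) ^ 3 :=
  Real.sq_sqrt (by positivity)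

/-- The error of the displaced coupling in the absence of rejections and later collisions. -/
noncomputable def stepError (σ ε u T η t v : ℝ) (z : ℝ × ℝ × ℝ) : ℝ :=
  -- Each summand is a product of functions of τ, ν and ξ separately (hence the factor 1), so that
  -- its integral factorises.
  (Set.Iio t).indicator (fun _ => 1) z.1 *
      ((|z.2.1 / ε - u| * (σ / ε ^ 2 * t ^ 2)
        + σ / ε ^ 2 * stepAmplitude σ ε T t ^ 2 * ε / (2 * η)) * 1)
    + stepScale t z.1 * (Real.sqrt (1.01 * σ / (3 * ε ^ 4)) *
        Real.sqrt (T + (z.2.1 - ε * u) ^ 2) * |z.2.2|)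
    - (Set.Iic (t / 2)).indicator (fun _ => 1) z.1 *
        ({ν | η ≤ |v - ν|}.indicator (fun _ => stepAmplitude σ ε T t) z.2.1 * |z.2.2|)

section

variable {σ ε u T η t v : ℝ}

theorem couplingGain_eq (c η h v τ ν : ℝ) :
    couplingGain c η h v τ ν =
      (Set.Iic h).indicator (fun _ => 1) τ * {ν | η ≤ |v - ν|}.indicator (fun _ => c) ν := by
  unfold couplingGain
  by_cases h1 : η ≤ |v - ν| <;> by_cases h2 : τ ≤ h <;> simp [h1, h2]

/-- The gain never exceeds the majorant of √s from which it is subtracted, which makes `stepError`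
nonnegative. -/
theorem stepAmplitude_le_stepScale (hσ : 0 < σ) (hε : 0 < ε) (hT : 0 < T) (ht : 0 < t)
    {τ : ℝ} (hτ : τ ≤ t / 2) (ν : ℝ) :
    stepAmplitude σ ε T t ≤ stepScale t τ * (Real.sqrt (1.01 * σ / (3 * ε ^ 4)) *
        Real.sqrt (T + (ν - ε * u) ^ 2)) := by
  have hlt : τ < t := by linarith
  have hθ : (t / 2) ^ 3 ≤ (t - τ) ^ 3 := pow_le_pow_left₀ (by positivity) (by linarith) 3
  have h0 : 0 ≤ (t - τ) ^ 3 := le_trans (by positivity) hθ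
  have h1 : stepScale t τ = Real.sqrt ((t - τ) ^ 3) :=
    Set.indicator_of_mem (show τ ∈ Set.Iio t from hlt) _
  rw [h1, ← Real.sqrt_mul (by positivity), ← Real.sqrt_mul h0, mul_comm ((t - τ) ^ 3)]
  refine Real.sqrt_le_sqrt (mul_le_mul ?_ hθ (by positivity) (by positivity))
  have h2 : T * σ / (12 * ε ^ 4) = 1.01 * σ / (3 * ε ^ 4) * (T * (1 / 4.04)) := by
    field_simp
    norm_num
  rw [h2]
  gcongr
  nlinarith [sq_nonneg (ν - ε * u)]

theorem stepError_eq (z : ℝ × ℝ × ℝ) :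
    stepError σ ε u T η t v z =
      (Set.Iio t).indicator (fun _ => |z.2.1 / ε - u| * (σ / ε ^ 2 * t ^ 2)
        + σ / ε ^ 2 * stepAmplitude σ ε T t ^ 2 * ε / (2 * η)) z.1
      + (stepScale t z.1 * (Real.sqrt (1.01 * σ / (3 * ε ^ 4)) *
        Real.sqrt (T + (z.2.1 - ε * u) ^ 2))
        - couplingGain (stepAmplitude σ ε T t) η (t / 2) v z.1 z.2.1) * |z.2.2| := by
  rw [couplingGain_eq]
  unfold stepError
  by_cases h : z.1 ∈ Set.Iio t
  · rw [Set.indicator_of_mem h, Set.indicator_of_mem h]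
    ring
  · rw [Set.indicator_of_notMem h, Set.indicator_of_notMem h]
    ring

theorem sub_couplingGain_nonneg (hσ : 0 < σ) (hε : 0 < ε) (hT : 0 < T) (ht : 0 < t)
    (τ ν : ℝ) :
    0 ≤ stepScale t τ * (Real.sqrt (1.01 * σ / (3 * ε ^ 4)) *
        Real.sqrt (T + (ν - ε * u) ^ 2)) - couplingGain (stepAmplitude σ ε T t) η (t / 2) v τ ν := by
  unfold couplingGain
  split_ifs with h
  · exact sub_nonneg.2 (stepAmplitude_le_stepScale hσ hε hT ht h.2 ν)
  · have := stepScale_nonneg t τ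
    rw [sub_zero]
    positivity

theorem stepError_nonneg (hσ : 0 < σ) (hε : 0 < ε) (hT : 0 < T) (hη : 0 < η) (ht : 0 < t)
    (z : ℝ × ℝ × ℝ) : 0 ≤ stepError σ ε u T η t v z := by
  rw [stepError_eq]
  exact add_nonneg (Set.indicator_nonneg (fun _ _ => by positivity) _)
    (mul_nonneg (sub_couplingGain_nonneg hσ hε hT ht _ _) (abs_nonneg _))

theorem measurable_couplingLoss (r c η h ε : ℝ) :
    Measurable fun y : (ℝ × ℝ) × ℝ × ℝ × ℝ =>
      couplingLoss r c η h ε y.1.2 y.2.1 y.2.2.1 y.2.2.2 := by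
  unfold couplingLoss
  refine Measurable.ite ?_ (by fun_prop) measurable_const
  have h0 : Measurable fun y : (ℝ × ℝ) × ℝ × ℝ × ℝ => (y.1.2, y.2.2.1) := by fun_prop
  have h1 : Measurable fun y : (ℝ × ℝ) × ℝ × ℝ × ℝ =>
      (flightAmplitude ε c η (y.1.2, y.2.2.1), y.2.1, y.2.2.2) :=
    ((measurable_flightAmplitude ε c η).comp h0).prodMk (by fun_prop)
  have h2 : MeasurableSet {y : (ℝ × ℝ) × ℝ × ℝ × ℝ | η ≤ |y.1.2 - y.2.2.1|} :=
    measurableSet_le measurable_const (by fun_prop)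
  have h3 : MeasurableSet {y : (ℝ × ℝ) × ℝ × ℝ × ℝ | y.2.1 ≤ h} :=
    measurableSet_le (by fun_prop) measurable_const
  exact (h2.inter h3).inter ((measurableSet_driftSet r h).preimage h1).compl

theorem measurable_couplingGain (c η h : ℝ) :
    Measurable fun y : (ℝ × ℝ) × ℝ × ℝ × ℝ => couplingGain c η h y.1.2 y.2.1 y.2.2.1 := by
  unfold couplingGain
  have h2 : MeasurableSet {y : (ℝ × ℝ) × ℝ × ℝ × ℝ | η ≤ |y.1.2 - y.2.2.1|} :=
    measurableSet_le measurable_const (by fun_prop)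
  have h3 : MeasurableSet {y : (ℝ × ℝ) × ℝ × ℝ × ℝ | y.2.1 ≤ h} :=
    measurableSet_le (by fun_prop) measurable_const
  exact Measurable.ite (h2.inter h3) measurable_const measurable_const

theorem measurable_stepError (σ ε u T η t : ℝ) :
    Measurable fun y : (ℝ × ℝ) × ℝ × ℝ × ℝ => stepError σ ε u T η t y.1.2 y.2 := by
  simp only [stepError_eq, Set.indicator_apply]
  have h1 : Measurable fun y : (ℝ × ℝ) × ℝ × ℝ × ℝ => stepScale t y.2.1 :=
    (measurable_stepScale t).comp (measurable_fst.comp measurable_snd)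
  have h2 : MeasurableSet {y : (ℝ × ℝ) × ℝ × ℝ × ℝ | y.2.1 ∈ Set.Iio t} :=
    (measurable_fst.comp measurable_snd) measurableSet_Iio
  exact (Measurable.ite h2 (by fun_prop) measurable_const).add
    (((h1.mul (by fun_prop)).sub (measurable_couplingGain _ η (t / 2))).mul (by fun_prop))

/-- The cost of the coupling is controlled by later collisions, the Gaussian step and rejected
displacements. -/
theorem phaseDist_coupling_le (hσ : 0 < σ) (hε : 0 < ε) (hT : 0 < T) (hη : 0 < η) (ht : 0 < t)
    (hs : σ / ε ^ 2 * t ≤ 1 / 1000) (κ : ℝ) {ω : ((ℝ × ℝ) × (ℕ → ℝ) × (ℕ → ℝ)) × ℝ}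
    (h0 : 0 ≤ ω.1.2.1 0)
    (hex : ∃ k, t ≤ collisionTime (displaceFlight (σ / ε ^ 2) (t / 2)
      (flightAmplitude ε (stepAmplitude σ ε T t) η) ω).2.1 (k + 1)) :
    phaseDist κ
        (kineticState ε t (exchangeVelocity t (displaceFlight (σ / ε ^ 2) (t / 2)
          (flightAmplitude ε (stepAmplitude σ ε T t) η) ω)))
        (kdState σ ε u T t (kdInput ω)) ≤
      laterCollisionError ε t (displaceFlight (σ / ε ^ 2) (t / 2)
          (flightAmplitude ε (stepAmplitude σ ε T t) η) ω)
        + (stepError σ ε u T η t (kdInput ω).1.2 (kdInput ω).2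
          + couplingLoss (σ / ε ^ 2) (stepAmplitude σ ε T t) η (t / 2) ε ω.1.1.2 (ω.1.2.1 0)
            (ω.1.2.2 0) ω.2) := by
  obtain ⟨⟨p, e, w⟩, ξ⟩ := ω
  have hr : 0 < σ / ε ^ 2 := by positivity
  have hc0 : 0 ≤ stepAmplitude σ ε T t := Real.sqrt_nonneg _
  have hvel := velocity_kineticState_exchangeVelocity (ε := ε) (p := p) (w := w) hex
  simp only [displaceFlight, kdInput, Function.update_self] at hvel h0 ⊢
  have herr := stepError_nonneg (u := u) (v := p.2) hσ hε hT hη ht (e 0, w 0, ξ)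
  set c := stepAmplitude σ ε T t with hc
  set τ' := driftMove (σ / ε ^ 2) (t / 2) (flightAmplitude ε c η (p.2, w 0)) (e 0, ξ) with hτ'
  have hlossnn : 0 ≤ couplingLoss (σ / ε ^ 2) c η (t / 2) ε p.2 (e 0) (w 0) ξ := by
    unfold couplingLoss
    split_ifs <;> positivity
  -- Accepted moves stay in [0, t/2], so the displacement never changes whether the first collision
  -- happens before t.
  have hiff : τ' < t ↔ e 0 < t := by
    rw [hτ']
    unfold driftMove
    split_ifs with hd
    · exact ⟨fun _ => by linarith [hd.1.2], fun _ => by linarith [hd.2.2]⟩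
    · exact Iff.rfl
  -- The final velocities coincide, so the κ-part of the distance vanishes.
  have hkin : (kineticState ε t (exchangeVelocity t (p, Function.update e 0 τ', w))).2 =
      (kdState σ ε u T t (p, e 0, w 0, ξ)).2 := by
    rw [hvel]
    simp only [hiff, kdState]
    split_ifs <;> rfl
  unfold phaseDist
  rw [hkin, sub_self, abs_zero, mul_zero, add_zero]
  refine (abs_sub_le _ (oneCollisionPosition ε t (p, Function.update e 0 τ', w)) _).trans ?_
  refine add_le_add le_rfl ?_
  by_cases hlt : e 0 < t
  · have hθ0 : 0 ≤ t - e 0 := by linarith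
    have hθs : σ / ε ^ 2 * (t - e 0) ≤ 1 / 1000 := by
      refine le_trans (mul_le_mul_of_nonneg_left ?_ hr.le) hs
      linarith
    have hone : oneCollisionPosition ε t (p, Function.update e 0 τ', w) =
        p.1 + p.2 / ε * τ' + w 0 / ε * (t - τ') := by
      simp only [oneCollisionPosition, Function.update_self]
      rw [if_pos (hiff.2 hlt)]
    have hkd : (kdState σ ε u T t (p, e 0, w 0, ξ)).1 = p.1 + p.2 / ε * e 0
        + (kdMean σ ε u (t - e 0) (w 0)
          + Real.sqrt (kdVar σ ε u T (t - e 0) (w 0)) * ξ) := by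
      simp only [kdState]
      rw [if_pos hlt]
    have hcs : e 0 ≤ t / 2 → c ≤ Real.sqrt (kdVar σ ε u T (t - e 0) (w 0)) := by
      intro hτ
      refine Real.sqrt_le_sqrt (le_trans ?_ (le_kdVar hσ hε hT hθ0 hθs))
      refine mul_le_mul_of_nonneg_left (pow_le_pow_left₀ (by positivity) (by linarith) 3)
        (by positivity)
    have hmain := abs_displaced_error_le (v := p.2) (ν := w 0) (ξ := ξ) (τ := e 0)
      (D := kdMean σ ε u (t - e 0) (w 0)) (θ := t - e 0) hε hη hr hcs (Real.sqrt_nonneg _)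
    rw [← hτ'] at hmain
    rw [hone, hkd]
    have hrw : p.1 + p.2 / ε * τ' + w 0 / ε * (t - τ') - (p.1 + p.2 / ε * e 0
        + (kdMean σ ε u (t - e 0) (w 0)
          + Real.sqrt (kdVar σ ε u T (t - e 0) (w 0)) * ξ)) =
        p.2 / ε * τ' + w 0 / ε * (e 0 + (t - e 0) - τ') - (p.2 / ε * e 0
        + (kdMean σ ε u (t - e 0) (w 0)
          + Real.sqrt (kdVar σ ε u T (t - e 0) (w 0)) * ξ)) := by ring
    rw [hrw]
    refine hmain.trans (add_le_add ?_ le_rfl)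
    rw [stepError_eq, Set.indicator_of_mem (show e 0 ∈ Set.Iio t from hlt)]
    have h1 : |w 0 / ε * (t - e 0) - kdMean σ ε u (t - e 0) (w 0)| ≤
        |w 0 / ε - u| * (σ / ε ^ 2 * t ^ 2) := by
      refine (abs_kdMean_sub_le hσ hε hθ0 hθs).trans ?_
      gcongr
      linarith
    have h2 := sqrt_kdVar_le (u := u) (ν := w 0) hσ hε hT hθ0 hθs
    have h3 : stepScale t (e 0) = Real.sqrt ((t - e 0) ^ 3) :=
      Set.indicator_of_mem (show e 0 ∈ Set.Iio t from hlt) _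
    rw [h3]
    refine add_le_add (add_le_add h1 le_rfl) (mul_le_mul_of_nonneg_right ?_ (abs_nonneg _))
    refine sub_le_sub_right (h2.trans (le_of_eq ?_)) _
    ring
  · have hone : oneCollisionPosition ε t (p, Function.update e 0 τ', w) = p.1 + p.2 / ε * t := by
      simp only [oneCollisionPosition, Function.update_self]
      rw [if_neg (mt hiff.1 hlt)]
    have hkd : (kdState σ ε u T t (p, e 0, w 0, ξ)).1 = p.1 + p.2 / ε * t := by
      simp only [kdState]
      rw [if_neg hlt]
    rw [hone, hkd, sub_self, abs_zero]
    exact add_nonneg herr hlossnn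

/-! ### Mean values -/

/-- The initial velocity v enters only through the probability that |v - ν| ≥ √T/2, bounded below
independently of v. This is the source of uniformity in f. -/
theorem integrable_stepError_and_integral_le (hσ : 0 < σ) (hε : 0 < ε) (hT : 0 < T) (ht : 0 < t)
    (hs : σ / ε ^ 2 * t ≤ 1 / 1000) (v : ℝ) :
    Integrable (stepError σ ε u T (Real.sqrt T / 2) t v) ((expMeasure (σ / ε ^ 2)).prod
        ((maxwellian ε u T).prod (gaussianReal 0 1))) ∧
      ∫ z, stepError σ ε u T (Real.sqrt T / 2) t v z ∂((expMeasure (σ / ε ^ 2)).prod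
        ((maxwellian ε u T).prod (gaussianReal 0 1))) ≤
      σ / ε ^ 2 * t * ((∫ ν, |ν / ε - u| ∂(maxwellian ε u T)) * (σ / ε ^ 2 * t ^ 2)
          + σ / ε ^ 2 * stepAmplitude σ ε T t ^ 2 * ε / Real.sqrt T)
        + σ / ε ^ 2 * (2 / 5 * Real.sqrt (t ^ 5)) * (Real.sqrt (1.01 * σ / (3 * ε ^ 4)) *
          Real.sqrt (2 * T) * Real.sqrt (2 / Real.pi))
        - 0.99 * (σ / ε ^ 2 * (t / 2)) * (0.6 * stepAmplitude σ ε T t *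
          Real.sqrt (2 / Real.pi)) := by
  have hr : 0 < σ / ε ^ 2 := by positivity
  have := isProbabilityMeasure_expMeasure hr
  have hsT : 0 < Real.sqrt T := Real.sqrt_pos.2 hT
  set r := σ / ε ^ 2
  set c := stepAmplitude σ ε T t with hc
  have hc0 : 0 ≤ c := Real.sqrt_nonneg _
  set η := Real.sqrt T / 2 with hη
  set G : Set ℝ := {ν | η ≤ |v - ν|} with hG
  have hGm : MeasurableSet G := measurableSet_le measurable_const (by fun_prop)
  have habs := integrable_abs_gaussianReal 0 1
  have hν : Integrable (fun ν => |ν / ε - u|) (maxwellian ε u T) := by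
    have h1 := (memLp_id_gaussianReal (μ := ε * u) (v := T.toNNReal) 1).integrable (by simp)
    exact ((h1.div_const ε).sub (integrable_const u)).abs
  have ha : Integrable (fun ν => |ν / ε - u| * (r * t ^ 2) + r * c ^ 2 * ε / (2 * η))
      (maxwellian ε u T) := (hν.mul_const _).add (integrable_const _)
  have hI1 : Integrable ((Set.Iio t).indicator fun _ => (1 : ℝ)) (expMeasure r) :=
    (integrable_const 1).indicator measurableSet_Iio
  have hI3 : Integrable ((Set.Iic (t / 2)).indicator fun _ => (1 : ℝ)) (expMeasure r) :=
    (integrable_const 1).indicator measurableSet_Iic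
  have hg : Integrable (G.indicator fun _ => c) (maxwellian ε u T) :=
    (integrable_const c).indicator hGm
  have hsq : Integrable (fun ν => Real.sqrt (1.01 * σ / (3 * ε ^ 4)) *
      Real.sqrt (T + (ν - ε * u) ^ 2)) (maxwellian ε u T) :=
    (integrable_sqrt_maxwellian hT).const_mul _
  have hP1 := hI1.mul_prod (ha.mul_prod (integrable_const (μ := gaussianReal 0 1) (1 : ℝ)))
  have hP2 := (integrable_stepScale hr.le t).mul_prod (hsq.mul_prod habs)
  have hP3 := hI3.mul_prod (hg.mul_prod habs)
  refine ⟨(hP1.add hP2).sub hP3, ?_⟩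
  have hint : ∫ z, stepError σ ε u T η t v z ∂((expMeasure r).prod
      ((maxwellian ε u T).prod (gaussianReal 0 1))) = _ :=
    (integral_sub (hP1.add hP2) hP3).trans
      (congrArg (fun y => y - _) (integral_add hP1 hP2))
  rw [hint, integral_prod_mul _ (fun y : ℝ × ℝ => (|y.1 / ε - u| * (r * t ^ 2)
      + r * c ^ 2 * ε / (2 * η)) * 1),
    integral_prod_mul _ (fun y : ℝ × ℝ => Real.sqrt (1.01 * σ / (3 * ε ^ 4)) *
      Real.sqrt (T + (y.1 - ε * u) ^ 2) * |y.2|),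
    integral_prod_mul _ (fun y : ℝ × ℝ => G.indicator (fun _ => c) y.1 * |y.2|),
    integral_prod_mul (fun ν => |ν / ε - u| * (r * t ^ 2) + r * c ^ 2 * ε / (2 * η))
      (fun _ : ℝ => (1 : ℝ)),
    integral_prod_mul (fun ν => Real.sqrt (1.01 * σ / (3 * ε ^ 4)) *
      Real.sqrt (T + (ν - ε * u) ^ 2)) (fun ξ : ℝ => |ξ|),
    integral_prod_mul (G.indicator fun _ => c) (fun ξ : ℝ => |ξ|),
    integral_abs_gaussianReal, integral_indicator_const _ hGm,
    integral_indicator_const _ measurableSet_Iio, integral_indicator_const _ measurableSet_Iic,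
    integral_add (hν.mul_const _) (integrable_const _), integral_mul_const, integral_const_mul]
  simp only [integral_const, probReal_univ, smul_eq_mul, one_mul, mul_one]
  have hη2 : 2 * η = Real.sqrt T := by
    rw [hη]
    ring
  rw [hη2]
  have hA : 0 ≤ ∫ ν, |ν / ε - u| ∂(maxwellian ε u T) := integral_nonneg fun _ => abs_nonneg _
  have e1 : (expMeasure r).real (Set.Iio t) ≤ r * t :=
    ENNReal.toReal_le_of_le_ofReal (by positivity) (expMeasure_Iio_le hr.le)
  have e2 := integral_stepScale_le hr.le ht.le
  have e3 := le_expMeasure_real_Iic hr (h := t / 2) (by positivity) (by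
    have : r * (t / 2) = r * t / 2 := by ring
    rw [this]
    linarith)
  have e4 := integral_sqrt_maxwellian_le (ε := ε) (u := u) hT
  have e5 : 0.6 ≤ (maxwellian ε u T).real G := le_maxwellian_real_far hT v
  have e6 : 0 ≤ ∫ ν, Real.sqrt (T + (ν - ε * u) ^ 2) ∂(maxwellian ε u T) :=
    integral_nonneg fun _ => Real.sqrt_nonneg _
  gcongr

/-- A rejection loses c|ξ| and has probability of order c, so for c of order t^{3/2} the mean loss
is O(t³). -/
theorem lintegral_couplingLoss_prod_le {r c : ℝ} (hr : 0 < r) [IsProbabilityMeasure (expMeasure r)]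
    (hε : 0 < ε) (hc : 0 ≤ c) (hη : 0 < η) (h v : ℝ) :
    ∫⁻ z, ENNReal.ofReal (couplingLoss r c η h ε v z.1 z.2.1 z.2.2)
        ∂((expMeasure r).prod ((maxwellian ε u T).prod (gaussianReal 0 1))) ≤
      ENNReal.ofReal (c * r * (c * ε / η + r * (c * ε / η) ^ 2 / 2 * Real.sqrt (2 / Real.pi))) := by
  have hm : Measurable fun z : ℝ × ℝ × ℝ =>
      ENNReal.ofReal (couplingLoss r c η h ε v z.1 z.2.1 z.2.2) :=
    ((measurable_couplingLoss r c η h ε).comp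
      (measurable_prodMk_left (x := ((0, v) : ℝ × ℝ)))).ennreal_ofReal
  rw [lintegral_prod_symm' _ hm]
  set K := c * ε / η with hK
  have hK0 : 0 ≤ K := by positivity
  have hb : ∀ y : ℝ × ℝ, ∫⁻ τ, ENNReal.ofReal (couplingLoss r c η h ε v τ y.1 y.2)
      ∂(expMeasure r) ≤ ENNReal.ofReal (c * r * (K * (y.2 - 0) ^ 2 + r * K ^ 2 / 2 * |y.2|)) := by
    intro y
    refine (lintegral_couplingLoss_le hr hc).trans (ENNReal.ofReal_le_ofReal ?_)
    have hk := abs_flightAmplitude_le hε hc hη (v, y.1)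
    set k := flightAmplitude ε c η (v, y.1)
    have h1 : |k * y.2 - r * k ^ 2 / 2| ≤ K * |y.2| + r * K ^ 2 / 2 := by
      refine (abs_sub _ _).trans (add_le_add ?_ ?_)
      · rw [abs_mul]
        gcongr
      · rw [abs_of_nonneg (by positivity), ← sq_abs k]
        gcongr
    calc c * |y.2| * (r * |k * y.2 - r * k ^ 2 / 2|)
        ≤ c * |y.2| * (r * (K * |y.2| + r * K ^ 2 / 2)) := by gcongr
      _ = c * r * (K * |y.2| ^ 2 + r * K ^ 2 / 2 * |y.2|) := by ring
      _ = _ := by rw [sq_abs, sub_zero]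
  have hi1 : Integrable (fun x : ℝ => K * (x - 0) ^ 2) (gaussianReal 0 1) :=
    (integrable_sub_sq_gaussianReal 0 0 1).const_mul K
  have hi2 : Integrable (fun x : ℝ => r * K ^ 2 / 2 * |x|) (gaussianReal 0 1) :=
    (integrable_abs_gaussianReal 0 1).const_mul _
  have hi : Integrable (fun x : ℝ => c * r * (K * (x - 0) ^ 2 + r * K ^ 2 / 2 * |x|))
      (gaussianReal 0 1) := (hi1.add hi2).const_mul _
  calc _ ≤ ∫⁻ y : ℝ × ℝ, ENNReal.ofReal (c * r * (K * (y.2 - 0) ^ 2 + r * K ^ 2 / 2 * |y.2|))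
        ∂((maxwellian ε u T).prod (gaussianReal 0 1)) := lintegral_mono hb
    _ ≤ ∫⁻ _, ∫⁻ x, ENNReal.ofReal (c * r * (K * (x - 0) ^ 2 + r * K ^ 2 / 2 * |x|))
        ∂(gaussianReal 0 1) ∂(maxwellian ε u T) := lintegral_prod_le _
    _ = ENNReal.ofReal (c * r * (K + r * K ^ 2 / 2 * Real.sqrt (2 / Real.pi))) := by
        rw [lintegral_const, measure_univ, mul_one,
          ← ofReal_integral_eq_lintegral_ofReal hi
            (ae_of_all _ fun x => by
              simp only [Pi.zero_apply]
              positivity),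
          integral_const_mul, integral_add hi1 hi2, integral_const_mul, integral_const_mul,
          integral_abs_gaussianReal, integral_sub_mean_sq_gaussianReal]
        simp

end

/-! ### The main estimate -/

theorem wassersteinOne_le_explicit {σ ε T : ℝ} (hσ : 0 < σ) (hε : 0 < ε) (hT : 0 < T) (u κ : ℝ)
    {t : ℝ} (ht : 0 < t) (hs : σ / ε ^ 2 * t ≤ 1 / 1000)
    (f : Measure (ℝ × ℝ)) [IsProbabilityMeasure f] :
    wassersteinOne (phaseDist κ) (kineticOperator σ ε u T t f) (kdOperator σ ε u T t f) ≤
      ENNReal.ofReal (2 * (∫ x, |x| ∂(maxwellian ε u T)) * (t / ε) * (σ / ε ^ 2 * t) ^ 2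
        + ((σ / ε ^ 2 * t * ((∫ ν, |ν / ε - u| ∂(maxwellian ε u T)) * (σ / ε ^ 2 * t ^ 2)
          + σ / ε ^ 2 * stepAmplitude σ ε T t ^ 2 * ε / Real.sqrt T)
        + σ / ε ^ 2 * (2 / 5 * Real.sqrt (t ^ 5)) * (Real.sqrt (1.01 * σ / (3 * ε ^ 4)) *
          Real.sqrt (2 * T) * Real.sqrt (2 / Real.pi))
        - 0.99 * (σ / ε ^ 2 * (t / 2)) * (0.6 * stepAmplitude σ ε T t *
          Real.sqrt (2 / Real.pi)))
        + stepAmplitude σ ε T t * (σ / ε ^ 2) * (stepAmplitude σ ε T t * ε / (Real.sqrt T / 2)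
          + σ / ε ^ 2 * (stepAmplitude σ ε T t * ε / (Real.sqrt T / 2)) ^ 2 / 2
            * Real.sqrt (2 / Real.pi)))) := by
  have hr : 0 < σ / ε ^ 2 := by positivity
  have hprob := isProbabilityMeasure_expMeasure hr
  have hsT : 0 < Real.sqrt T := Real.sqrt_pos.2 hT
  have hη : 0 < Real.sqrt T / 2 := by positivity
  have hc0 : 0 ≤ stepAmplitude σ ε T t := Real.sqrt_nonneg _
  have hk := measurable_flightAmplitude ε (stepAmplitude σ ε T t) (Real.sqrt T / 2)
  have hd := measurePreserving_displaceFlight hr u T (t / 2) hk f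
  have hi := measurePreserving_kdInput hr u T f
  have hmE : ∀ v, ∫⁻ z, ENNReal.ofReal (stepError σ ε u T (Real.sqrt T / 2) t v z)
      ∂((expMeasure (σ / ε ^ 2)).prod ((maxwellian ε u T).prod (gaussianReal 0 1))) ≤ _ := fun v =>
    (ofReal_integral_eq_lintegral_ofReal
      (integrable_stepError_and_integral_le (u := u) hσ hε hT ht hs v).1
      (ae_of_all _ (stepError_nonneg hσ hε hT hη ht))).symm.le.trans (ENNReal.ofReal_le_ofReal
        (integrable_stepError_and_integral_le (u := u) hσ hε hT ht hs v).2)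
  have hmL := fun v => lintegral_couplingLoss_prod_le (u := u) (T := T) hr hε hc0 hη (t / 2) v
  -- The explicit bound contains a subtraction. Its sign is inherited from the nonnegative
  -- integrand, for any choice of v.
  have hX0 := (integral_nonneg (μ := (expMeasure (σ / ε ^ 2)).prod
    ((maxwellian ε u T).prod (gaussianReal 0 1)))
    (stepError_nonneg (u := u) (v := 0) hσ hε hT hη ht)).trans
    (integrable_stepError_and_integral_le (u := u) hσ hε hT ht hs 0).2
  set r := σ / ε ^ 2
  set c := stepAmplitude σ ε T t
  set η := Real.sqrt T / 2
  set D := displaceFlight r (t / 2) (flightAmplitude ε c η)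
  set P := (kineticInput σ ε u T f).prod (gaussianReal 0 1)
  set Q := (expMeasure r).prod ((maxwellian ε u T).prod (gaussianReal 0 1))
  set X := r * t * ((∫ ν, |ν / ε - u| ∂(maxwellian ε u T)) * (r * t ^ 2)
          + r * c ^ 2 * ε / Real.sqrt T)
        + r * (2 / 5 * Real.sqrt (t ^ 5)) * (Real.sqrt (1.01 * σ / (3 * ε ^ 4)) *
          Real.sqrt (2 * T) * Real.sqrt (2 / Real.pi))
        - 0.99 * (r * (t / 2)) * (0.6 * c * Real.sqrt (2 / Real.pi))
  set Y := c * r * (c * ε / η + r * (c * ε / η) ^ 2 / 2 * Real.sqrt (2 / Real.pi))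
  have hY0 : 0 ≤ Y := by positivity
  set F : (ℝ × ℝ) × ℝ × ℝ × ℝ → ENNReal := fun y =>
    ENNReal.ofReal (stepError σ ε u T η t y.1.2 y.2)
      + ENNReal.ofReal (couplingLoss r c η (t / 2) ε y.1.2 y.2.1 y.2.2.1 y.2.2.2)
  have hm0 : 0 ≤ ∫ x, |x| ∂(maxwellian ε u T) := integral_nonneg fun _ => abs_nonneg _
  have hfst : MeasurePreserving (fun ω : ((ℝ × ℝ) × (ℕ → ℝ) × (ℕ → ℝ)) × ℝ => ω.1) P
      (kineticInput σ ε u T f) := by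
    have : IsProbabilityMeasure (kineticInput σ ε u T f) := by
      unfold kineticInput
      infer_instance
    exact measurePreserving_fst
  have hflights : MeasurePreserving (fun ω : (ℝ × ℝ) × (ℕ → ℝ) × (ℕ → ℝ) => ω.2.1)
      (kineticInput σ ε u T f) (Measure.infinitePi fun _ : ℕ => expMeasure r) :=
    measurePreserving_fst.comp measurePreserving_snd
  have hae1 : ∀ᵐ ω ∂P, 0 ≤ ω.1.2.1 0 := by
    filter_upwards [(hflights.comp hfst).quasiMeasurePreserving.ae
      (ae_nonneg_flightTimes hr)] with ω hω using hω 0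
  have hae2 : ∀ᵐ ω ∂P, ∃ k, t ≤ collisionTime (D ω).2.1 (k + 1) :=
    (hflights.comp hd).quasiMeasurePreserving.ae
      (ae_exists_le_collisionTime hr (t := t) (by linarith))
  have hpt : ∀ᵐ ω ∂P, ENNReal.ofReal (phaseDist κ
      (kineticState ε t (exchangeVelocity t (D ω))) (kdState σ ε u T t (kdInput ω))) ≤
      ENNReal.ofReal (laterCollisionError ε t (D ω)) + F (kdInput ω) := by
    filter_upwards [hae1, hae2] with ω h1 h2
    refine (ENNReal.ofReal_le_ofReal
      (phaseDist_coupling_le hσ hε hT hη ht hs κ h1 h2)).trans ?_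
    refine ENNReal.ofReal_add_le.trans (add_le_add le_rfl ?_)
    exact ENNReal.ofReal_add_le
  have hlater : ∫⁻ ω, ENNReal.ofReal (laterCollisionError ε t (D ω)) ∂P ≤
      ENNReal.ofReal (2 * (∫ x, |x| ∂(maxwellian ε u T)) * (t / ε) * (r * t) ^ 2) := by
    have hcomp : ∫⁻ ω, ENNReal.ofReal (laterCollisionError ε t (D ω)) ∂P = _ :=
      hd.lintegral_comp (measurable_laterCollisionError ε t).ennreal_ofReal
    rw [hcomp]
    refine (lintegral_laterCollisionError_le hσ hε u T ht.le (by linarith) f).trans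
      (le_of_eq ?_)
    have hm : ∫⁻ x, ENNReal.ofReal |x| ∂(maxwellian ε u T) =
        ENNReal.ofReal (∫ x, |x| ∂(maxwellian ε u T)) :=
      (ofReal_integral_eq_lintegral_ofReal (integrable_abs_gaussianReal _ _)
        (ae_of_all _ fun _ => abs_nonneg _)).symm
    symm
    rw [hm, ENNReal.ofReal_mul (by positivity), ENNReal.ofReal_mul (by positivity),
      ENNReal.ofReal_mul zero_le_two, ENNReal.ofReal_pow (by positivity), ENNReal.ofReal_ofNat]
  have hstep : ∀ p : ℝ × ℝ, ∫⁻ z, F (p, z) ∂Q ≤ ENNReal.ofReal (X + Y) := by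
    intro p
    have hmeas : Measurable fun z => ENNReal.ofReal (stepError σ ε u T η t p.2 z) :=
      ((measurable_stepError σ ε u T η t).comp (measurable_prodMk_left (x := p))).ennreal_ofReal
    change ∫⁻ z, ENNReal.ofReal (stepError σ ε u T η t p.2 z)
      + ENNReal.ofReal (couplingLoss r c η (t / 2) ε p.2 z.1 z.2.1 z.2.2) ∂Q ≤ _
    rw [lintegral_add_left hmeas, ENNReal.ofReal_add hX0 hY0]
    exact add_le_add (hmE p.2) (hmL p.2)
  calc _ ≤ ∫⁻ ω, ENNReal.ofReal (phaseDist κ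
          (kineticState ε t (exchangeVelocity t (D ω))) (kdState σ ε u T t (kdInput ω))) ∂P :=
        wassersteinOne_le_coupling hr u T κ t (t / 2) hk f
    _ ≤ ∫⁻ ω, ENNReal.ofReal (laterCollisionError ε t (D ω)) + F (kdInput ω) ∂P :=
        lintegral_mono_ae hpt
    _ = (∫⁻ ω, ENNReal.ofReal (laterCollisionError ε t (D ω)) ∂P) + ∫⁻ ω, F (kdInput ω) ∂P :=
        lintegral_add_left ((measurable_laterCollisionError ε t).comp
          hd.measurable).ennreal_ofReal _
    _ ≤ ENNReal.ofReal (2 * (∫ x, |x| ∂(maxwellian ε u T)) * (t / ε) * (r * t) ^ 2)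
        + ENNReal.ofReal (X + Y) := by
        refine add_le_add hlater ?_
        have hFm : Measurable F := (measurable_stepError σ ε u T η t).ennreal_ofReal.add
          (measurable_couplingLoss r c η (t / 2) ε).ennreal_ofReal
        rw [hi.lintegral_comp hFm]
        refine (lintegral_prod_le _).trans ?_
        refine (lintegral_mono hstep).trans (le_of_eq ?_)
        simp
    _ = _ := by
        rw [← ENNReal.ofReal_add (by positivity) (add_nonneg hX0 hY0)]

/-- Both terms are exact multiples of √(Tσ³t⁵/ε⁸), so only numerical constants remain to be
compared. -/
theorem amplitude_sum_le {σ ε T : ℝ} (hσ : 0 < σ) (hε : 0 < ε) (hT : 0 < T) {t : ℝ}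
    (ht : 0 < t) :
    σ / ε ^ 2 * (2 / 5 * Real.sqrt (t ^ 5)) * (Real.sqrt (1.01 * σ / (3 * ε ^ 4)) *
          Real.sqrt (2 * T) * Real.sqrt (2 / Real.pi))
        - 0.99 * (σ / ε ^ 2 * (t / 2)) * (0.6 * stepAmplitude σ ε T t *
          Real.sqrt (2 / Real.pi)) ≤
      0.239 * Real.sqrt (T * σ ^ 3 * t ^ 5 / ε ^ 8) := by
  set S := Real.sqrt (T * σ ^ 3 * t ^ 5 / ε ^ 8) with hS
  have hS0 : 0 ≤ S := Real.sqrt_nonneg _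
  have hr : 0 ≤ σ / ε ^ 2 := by positivity
  have h1 : σ / ε ^ 2 * Real.sqrt (t ^ 5) * (Real.sqrt (1.01 * σ / (3 * ε ^ 4)) *
      Real.sqrt (2 * T)) = Real.sqrt (2.02 / 3) * S := by
    rw [hS]
    conv_lhs => rw [← Real.sqrt_sq hr]
    rw [← Real.sqrt_mul (by positivity), ← Real.sqrt_mul (by positivity),
      ← Real.sqrt_mul (by positivity), ← Real.sqrt_mul (by positivity)]
    congr 1
    field_simp
    norm_num
  have h2 : σ / ε ^ 2 * t * stepAmplitude σ ε T t = Real.sqrt (1 / 96) * S := by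
    rw [hS]
    unfold stepAmplitude
    conv_lhs => rw [← Real.sqrt_sq (by positivity : 0 ≤ σ / ε ^ 2 * t)]
    rw [← Real.sqrt_mul (by positivity), ← Real.sqrt_mul (by positivity)]
    congr 1
    field_simp
    norm_num
  have h3 : Real.sqrt (2.02 / 3) ≤ 0.8206 := Real.sqrt_le_iff.2 (by norm_num)
  have h4 : 0.102 ≤ Real.sqrt (1 / 96) := Real.le_sqrt_of_sq_le (by norm_num)
  have h5 : Real.sqrt (2 / Real.pi) ≤ 0.7979 := by
    refine Real.sqrt_le_iff.2 ⟨by norm_num, ?_⟩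
    rw [div_le_iff₀ Real.pi_pos]
    have := Real.pi_gt_d6
    norm_num at this ⊢
    linarith
  have h6 : 0 ≤ Real.sqrt (2 / Real.pi) := Real.sqrt_nonneg _
  set z := Real.sqrt (2 / Real.pi)
  -- Here 2.02/3 = 1.01·2/3, 0.297 = 0.99·0.6/2, and 96 = 12·2³ comes from (t/2)³ in the amplitude.
  calc _ = (2 / 5 * Real.sqrt (2.02 / 3) - 0.297 * Real.sqrt (1 / 96)) * S * z := by
        linear_combination 2 / 5 * z * h1 - 0.297 * z * h2
    _ ≤ (2 / 5 * 0.8206 - 0.297 * 0.102) * S * 0.7979 := by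
        gcongr
    _ ≤ 0.239 * S := by
        nlinarith

theorem exists_cubic_bound {σ ε T : ℝ} (hσ : 0 < σ) (hε : 0 < ε) (hT : 0 < T) (u κ : ℝ) :
    ∃ K : ℝ, 0 ≤ K ∧ ∀ (f : Measure (ℝ × ℝ)) [IsProbabilityMeasure f] (t : ℝ), 0 < t → t ≤ 1 →
      σ / ε ^ 2 * t ≤ 1 / 1000 →
      wassersteinOne (phaseDist κ) (kineticOperator σ ε u T t f) (kdOperator σ ε u T t f) ≤
        ENNReal.ofReal (0.239 * Real.sqrt (T * σ ^ 3 * t ^ 5 / ε ^ 8) + K * t ^ 3) := by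
  have hsT : 0 < Real.sqrt T := Real.sqrt_pos.2 hT
  have hA1 : 0 ≤ ∫ x, |x| ∂(maxwellian ε u T) := integral_nonneg fun _ => abs_nonneg _
  have hA2 : 0 ≤ ∫ ν, |ν / ε - u| ∂(maxwellian ε u T) := integral_nonneg fun _ => abs_nonneg _
  set r := σ / ε ^ 2 with hr
  have hr0 : 0 < r := by positivity
  set q := T * σ / (96 * ε ^ 4) with hq
  have hq0 : 0 < q := by positivity
  set z := Real.sqrt (2 / Real.pi) with hz
  have hz0 : 0 ≤ z := Real.sqrt_nonneg _
  set η := Real.sqrt T / 2 with hη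
  have hη0 : 0 < η := by positivity
  set m₁ := ∫ x, |x| ∂(maxwellian ε u T)
  set m₂ := ∫ ν, |ν / ε - u| ∂(maxwellian ε u T)
  -- In order: later collisions, the discrepancy of the means, the drift of the displacement, and
  -- the two parts of the rejection loss. Surplus powers of t are dropped using t ≤ 1.
  refine ⟨2 * m₁ * r ^ 2 / ε + r ^ 2 * m₂ + r ^ 2 * q * ε / Real.sqrt T + r * ε / η * q
    + r ^ 2 * ε ^ 2 / (2 * η ^ 2) * z * (Real.sqrt q * q), by positivity,
    fun f _ t ht ht1 hs => ?_⟩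
  refine (wassersteinOne_le_explicit hσ hε hT u κ ht hs f).trans (ENNReal.ofReal_le_ofReal ?_)
  have hlead := amplitude_sum_le hσ hε hT ht
  have hc2 : stepAmplitude σ ε T t ^ 2 = q * t ^ 3 := by
    rw [stepAmplitude_sq hσ hε hT ht.le, hq]
    field_simp
    norm_num
  have hc0 : 0 ≤ stepAmplitude σ ε T t := Real.sqrt_nonneg _
  rw [← hr, ← hz] at hlead ⊢
  set c := stepAmplitude σ ε T t
  have ht3 : t ^ 3 ≤ 1 := pow_le_one₀ ht.le ht1
  have hcq : c ≤ Real.sqrt q := by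
    refine Real.le_sqrt_of_sq_le ?_
    rw [hc2]
    exact mul_le_of_le_one_right hq0.le ht3
  have hX : r * t * (r * c ^ 2 * ε / Real.sqrt T) ≤ r ^ 2 * q * ε / Real.sqrt T * t ^ 3 := by
    have : r * t * (r * c ^ 2 * ε / Real.sqrt T) = t * (r ^ 2 * q * ε / Real.sqrt T * t ^ 3) := by
      rw [hc2]
      ring
    rw [this]
    exact mul_le_of_le_one_left (by positivity) ht1
  have hY : r ^ 2 * ε ^ 2 / (2 * η ^ 2) * z * (c * c ^ 2) ≤
      r ^ 2 * ε ^ 2 / (2 * η ^ 2) * z * (Real.sqrt q * q) * t ^ 3 := by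
    rw [hc2]
    calc _ ≤ r ^ 2 * ε ^ 2 / (2 * η ^ 2) * z * (Real.sqrt q * (q * t ^ 3)) := by gcongr
      _ = _ := by ring
  have hYeq : c * r * (c * ε / η + r * (c * ε / η) ^ 2 / 2 * z) =
      r * ε / η * q * t ^ 3 + r ^ 2 * ε ^ 2 / (2 * η ^ 2) * z * (c * c ^ 2) := by
    have : r * ε / η * q * t ^ 3 = r * ε / η * c ^ 2 := by
      rw [hc2]
      ring
    rw [this]
    field_simp
  have hLeq : 2 * m₁ * (t / ε) * (r * t) ^ 2 = 2 * m₁ * r ^ 2 / ε * t ^ 3 := by ring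
  rw [hYeq, hLeq]
  linarith

theorem mainTheorem2 (σ ε u T κ : ℝ) (hσ : 0 < σ) (hε : 0 < ε) (hT : 0 < T) (hκ : 0 ≤ κ) :
    ∃ C δ : ℝ, 0 < δ ∧
      ∀ (f : Measure (ℝ × ℝ)) [IsProbabilityMeasure f] (Δt : ℝ), 0 < Δt → Δt ≤ δ →
        wassersteinOne (phaseDist κ) (kineticOperator σ ε u T Δt f) (kdOperator σ ε u T Δt f) ≤
          ENNReal.ofReal (0.24959 * Real.sqrt (T * σ ^ 3 * Δt ^ 5 / ε ^ 8)
            + C * Real.sqrt (Δt ^ 7)) := by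
  obtain ⟨K, hK, hbound⟩ := exists_cubic_bound hσ hε hT u κ
  set S := Real.sqrt (T * σ ^ 3 / ε ^ 8) with hS
  have hS0 : 0 < S := Real.sqrt_pos.2 (by positivity)
  have hr : 0 < σ / ε ^ 2 := by positivity
  -- C = 0 suffices: Kt³ = K√t·√(t⁵), and the last entry of the minimum gives K√t ≤ 0.01·S, within
  -- the gap 0.24959 - 0.239. The denominator K + 1 stays positive even if K = 0.
  refine ⟨0, min (min 1 ((1000 * (σ / ε ^ 2))⁻¹)) ((0.01 * S / (K + 1)) ^ 2), by positivity,
    fun f _ t ht hδ => ?_⟩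
  obtain ⟨h12, h3⟩ := le_min_iff.1 hδ
  obtain ⟨h1, h2⟩ := le_min_iff.1 h12
  have hs : σ / ε ^ 2 * t ≤ 1 / 1000 := by
    refine (mul_le_mul_of_nonneg_left h2 hr.le).trans (le_of_eq ?_)
    field_simp
  refine (hbound f t ht h1 hs).trans (ENNReal.ofReal_le_ofReal ?_)
  rw [zero_mul, add_zero]
  have hsqrt : Real.sqrt t ≤ 0.01 * S / (K + 1) := Real.sqrt_le_iff.2 ⟨by positivity, h3⟩
  have hS5 : Real.sqrt (T * σ ^ 3 * t ^ 5 / ε ^ 8) = S * Real.sqrt (t ^ 5) := by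
    rw [hS, ← Real.sqrt_mul (by positivity)]
    congr 1
    ring
  have ht3 : t ^ 3 = Real.sqrt t * Real.sqrt (t ^ 5) := by
    rw [← Real.sqrt_mul ht.le]
    have : t * t ^ 5 = (t ^ 3) ^ 2 := by ring
    rw [this, Real.sqrt_sq (by positivity)]
  have hKt : K * Real.sqrt t ≤ 0.01 * S := by
    rw [le_div_iff₀ (by positivity)] at hsqrt
    nlinarith [Real.sqrt_nonneg t]
  have h5 : 0 ≤ Real.sqrt (t ^ 5) := Real.sqrt_nonneg _
  rw [hS5, ht3]
  nlinarith [mul_le_mul_of_nonneg_right hKt h5, mul_nonneg hS0.le h5]
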